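/- **Definitions.** A *network* $(G,c)$ is a connected, locally finite multigraph $G=(V,E)$ (loops and multiple edges allowed) together with a conductance $c(e)\in(0,\infty)$ for every edge $e\in E$; $c(u,v)$ denotes the sum of the conductances of the edges joining $u$ and $v$, and $c(u)$ the sum of the conductances of the edges emanating from $u$. A network is *recurrent* if the discrete-time random walk on it, with transition probabilities $c(u,v)/c(u)$, returns almost surely to its starting vertex, for every starting vertex. (On the network with one vertex and no edges the walk stays put.) Let $\mathcal G_\bullet$ (resp. $\mathcal G_{\bullet\bullet}$) be the space of isomorphism classes of networks with a root $\rho$ (resp. with an ordered pair of not necessarily distinct roots), with the local topology: two rooted networks are close if large balls around their (first) roots are isomorphic by an isomorphism that preserves the root(s) and almost preserves the conductances. Both spaces carry their Borel $\sigma$-algebras. A *random rooted network* is a random variable $(G,c,\rho)$ with values in $\mathcal G_\bullet$. It is *recurrent* if $(G,c)$ is recurrent almost surely, and *unimodular* if for every Borel function $f:\mathcal G_{\bullet\bullet}\to[0,\infty]$ $$\mathbb E\Big[\sum_{v\in V} f(G,c,\rho,v)\Big]=\mathbb E\Big[\sum_{u\in V} f(G,c,u,\rho)\Big].$$ The *continuous-time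 random walk* on a network $(G,c)$ jumps across each edge $e$ at its current position at rate $c(e)$: it is the right-continuous $V$-valued Markov process whose transition function is the minimal nonnegative solution of the backward equation for the rates $c(u,v)$. **Theorem.** Let $(G,c,\rho)$ be a recurrent unimodular random rooted network. Then almost surely the network $(G,c)$ has the following property: for all vertices $u,v$ of $G$, if $\langle X_t\rangle_{t\ge0}$ and $\langle Y_t\rangle_{t\ge0}$ are independent continuous-time random walks on $(G,c)$ started from $u$ and from $v$ respectively, then the set of times $\{t\ge 0: X_t=Y_t\}$ has infinite Lebesgue measure almost surely. -/

import Mathlib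

open MeasureTheory ProbabilityTheory Filter Topology
open scoped NNReal ENNReal

noncomputable section

/-- A network: a connected, locally finite multigraph (loops and multiple edges are allowed),
with vertex set `V`, edge set `E` and unordered pairs of end points `ends`, together with a
positive conductance on every edge. Such a graph is countable, so that every network has an
isomorphic copy with `V` and `E` in `Type`. -/
structure Network where
  V : Type
  E : Type
  ends : E → Sym2 V
  cond : E → ℝ
  cond_pos : ∀ e, 0 < cond e
  locallyFinite : ∀ v, {e | v ∈ ends e}.Finite
  connected : (SimpleGraph.fromEdgeSet (Set.range ends)).Connected

namespace Network

/-- The simple graph obtained by forgetting loops and multiplicities; it has the same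
graph distance. -/
def simpleGraph (N : Network) : SimpleGraph N.V :=
  SimpleGraph.fromEdgeSet (Set.range N.ends)

/-- The vertices at graph distance at most `r` from `x`. -/
def ball (N : Network) (x : N.V) (r : ℕ) : Set N.V :=
  {v | N.simpleGraph.dist x v ≤ r}

/-- The edges with both end points at graph distance at most `r` from `x`. -/
def ballEdges (N : Network) (x : N.V) (r : ℕ) : Set N.E :=
  {e | ∀ v ∈ N.ends e, v ∈ N.ball x r}

/-- Vertices of a network form a discrete (countable) space. -/
instance instMeasurableSpaceV (N : Network) : MeasurableSpace N.V := ⊤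

/-- An isomorphism of networks: bijections of vertices and edges respecting incidences and
conductances. -/
structure Iso (N N' : Network) where
  onV : N.V ≃ N'.V
  onE : N.E ≃ N'.E
  map_ends : ∀ e, N'.ends (onE e) = (N.ends e).map onV
  map_cond : ∀ e, N'.cond (onE e) = N.cond e

namespace Iso

def refl (N : Network) : Iso N N where
  onV := Equiv.refl _
  onE := Equiv.refl _
  map_ends e := by simp
  map_cond e := rfl

def symm {N N' : Network} (φ : Iso N N') : Iso N' N where
  onV := φ.onV.symm
  onE := φ.onE.symm
  map_ends e := by
    have h := φ.map_ends (φ.onE.symm e)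
    rw [Equiv.apply_symm_apply] at h
    rw [h, Sym2.map_map]
    simp
  map_cond e := by
    have h := φ.map_cond (φ.onE.symm e)
    rw [Equiv.apply_symm_apply] at h
    exact h.symm

def trans {N N' N'' : Network} (φ : Iso N N') (ψ : Iso N' N'') : Iso N N'' where
  onV := φ.onV.trans ψ.onV
  onE := φ.onE.trans ψ.onE
  map_ends e := by simp [ψ.map_ends, φ.map_ends, Sym2.map_map]
  map_cond e := by simp [ψ.map_cond, φ.map_cond]

end Iso

/-- An isomorphism between the ball of radius `r` around `x` in `N` and the ball of radius `r`
around `x'` in `N'` under which the conductances of corresponding edges differ by less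
than `ε`. All edges between two vertices of a ball belong to it; the last field says that
corresponding edges have corresponding end points. -/
structure BallIso (N : Network) (x : N.V) (N' : Network) (x' : N'.V) (r : ℕ) (ε : ℝ) where
  onV : N.ball x r ≃ N'.ball x' r
  onE : N.ballEdges x r ≃ N'.ballEdges x' r
  cond_lt : ∀ e : N.ballEdges x r, |N'.cond (onE e) - N.cond e| < ε
  mem_ends : ∀ (e : N.ballEdges x r) (v : N.ball x r),
    (v : N.V) ∈ N.ends e ↔ (onV v : N'.V) ∈ N'.ends (onE e)

/-- `φ` maps `y` to `y'` (in particular, both lie in the balls). -/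
def BallIso.Sends {N : Network} {x : N.V} {N' : Network} {x' : N'.V} {r : ℕ} {ε : ℝ}
    (φ : BallIso N x N' x' r ε) (y : N.V) (y' : N'.V) : Prop :=
  ∃ v : N.ball x r, (v : N.V) = y ∧ (φ.onV v : N'.V) = y'

/-! ### Random walks on a network -/

/-- `c(u, v)`: the sum of the conductances of the edges joining `u` and `v`. -/
def rate (N : Network) (u v : N.V) : ℝ≥0∞ :=
  ∑' e : {e : N.E // N.ends e = s(u, v)}, ENNReal.ofReal (N.cond e)

/-- `c(u)`: the (finite) sum of the conductances of the edges emanating from `u`. -/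
def totalRate (N : Network) (u : N.V) : ℝ≥0∞ :=
  ∑' e : {e : N.E // u ∈ N.ends e}, ENNReal.ofReal (N.cond e)

open Classical in
/-- The transition probabilities `c(u, v) / c(u)` of the discrete-time random walk. On the
network with a single vertex and no edges the walk stays where it is. -/
def stepProb (N : Network) (u v : N.V) : ℝ≥0∞ :=
  if N.totalRate u = 0 then (if u = v then 1 else 0) else N.rate u v / N.totalRate u

open Classical in
/-- The probability that the discrete-time random walk started from `u` visits `v` at time
`n + 1`, and at none of the times `1, …, n`. -/
def firstVisitProb (N : Network) (v : N.V) : ℕ → N.V → ℝ≥0∞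
  | 0, u => N.stepProb u v
  | n + 1, u => ∑' w, if w = v then 0 else N.stepProb u w * N.firstVisitProb v n w

/-- A network is recurrent if the discrete-time random walk started from any vertex returns
to that vertex with probability one. -/
def Recurrent (N : Network) : Prop :=
  ∀ v, ∑' n, N.firstVisitProb v n v = 1

open Classical in
/-- The probability that the continuous-time random walk started from `u`, which crosses each
edge `e` at its current position at rate `c(e)`, has made fewer than `n` jumps by time
`t ≥ 0` and is at `v` at time `t`. The recursion conditions on the time `s` and the target `w` of the
first jump. (Crossing a loop counts as a jump.) -/
def heatKernelAux (N : Network) : ℕ → ℝ → N.V → N.V → ℝ≥0∞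
  | 0, _, _, _ => 0
  | n + 1, t, u, v =>
      (if u = v then ENNReal.ofReal (Real.exp (-((N.totalRate u).toReal * t))) else 0) +
        ∫⁻ s in Set.Icc 0 t, ENNReal.ofReal (Real.exp (-((N.totalRate u).toReal * s))) *
          ∑' w, N.rate u w * N.heatKernelAux n (t - s) w v

/-- The transition function `p_t(u, v)`, `t ≥ 0`, of the continuous-time random walk: the minimal
nonnegative solution of the backward equation for the rates `c(u, v)`. -/
def heatKernel (N : Network) (t : ℝ) (u v : N.V) : ℝ≥0∞ :=
  ⨆ n, N.heatKernelAux n t u v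

/-- `X` is a continuous-time random walk on the network `N` started from `u`: a process with
right-continuous paths in the discrete space `N.V` whose finite-dimensional distributions are
those of the Markov process with starting point `u` and transition function `heatKernel`
(the case `n = 0` of `fdd` says that `X 0 = u` almost surely). -/
structure IsContinuousTimeWalk (N : Network) (u : N.V) {Ω : Type*} [MeasurableSpace Ω]
    (P : Measure Ω) (X : ℝ≥0 → Ω → N.V) : Prop where
  measurable : ∀ t, Measurable (X t)
  rightContinuous : ∀ᵐ ω ∂P, ∀ t, ∀ᶠ s in 𝓝[≥] t, X s ω = X t ω
  fdd : ∀ (n : ℕ) (t : ℕ → ℝ≥0) (x : ℕ → N.V), Monotone t → t 0 = 0 → x 0 = u →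
    P {ω | ∀ i ≤ n, X (t i) ω = x i} =
      ∏ i ∈ Finset.range n, N.heatKernel ((t (i + 1) : ℝ) - t i) (x i) (x (i + 1))

end Network

/-! ### The spaces of rooted and doubly rooted networks -/

/-- A network with a root. -/
structure RootedNetwork extends Network where
  root : V

/-- A network with an ordered pair of (not necessarily distinct) roots. -/
structure DoublyRootedNetwork extends Network where
  root₁ : V
  root₂ : V

instance RootedNetwork.setoid : Setoid RootedNetwork where
  r N N' := ∃ φ : Network.Iso N.toNetwork N'.toNetwork, φ.onV N.root = N'.root
  iseqv :=
    { refl := fun N => ⟨Network.Iso.refl _, rfl⟩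
      symm := by
        rintro N N' ⟨φ, h⟩
        exact ⟨φ.symm, by rw [← h]; exact φ.onV.symm_apply_apply _⟩
      trans := by
        rintro N N' N'' ⟨φ, h⟩ ⟨ψ, h'⟩
        exact ⟨φ.trans ψ, by rw [← h', ← h]; rfl⟩ }

instance DoublyRootedNetwork.setoid : Setoid DoublyRootedNetwork where
  r N N' := ∃ φ : Network.Iso N.toNetwork N'.toNetwork,
    φ.onV N.root₁ = N'.root₁ ∧ φ.onV N.root₂ = N'.root₂
  iseqv :=
    { refl := fun N => ⟨Network.Iso.refl _, rfl, rfl⟩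
      symm := by
        rintro N N' ⟨φ, h₁, h₂⟩
        exact ⟨φ.symm, by rw [← h₁]; exact φ.onV.symm_apply_apply _,
          by rw [← h₂]; exact φ.onV.symm_apply_apply _⟩
      trans := by
        rintro N N' N'' ⟨φ, h₁, h₂⟩ ⟨ψ, h₁', h₂'⟩
        exact ⟨φ.trans ψ, by rw [← h₁', ← h₁]; rfl, by rw [← h₂', ← h₂]; rfl⟩ }

/-- The space of isomorphism classes of rooted networks. -/
def RootedNetworkSpace : Type 1 := Quotient RootedNetwork.setoid

/-- The space of isomorphism classes of doubly rooted networks. -/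
def DoublyRootedNetworkSpace : Type 1 := Quotient DoublyRootedNetwork.setoid

/-- The isomorphism class of a rooted network. -/
def RootedNetwork.toClass (N : RootedNetwork) : RootedNetworkSpace :=
  Quotient.mk RootedNetwork.setoid N

/-- The isomorphism class of a doubly rooted network. -/
def DoublyRootedNetwork.toClass (N : DoublyRootedNetwork) : DoublyRootedNetworkSpace :=
  Quotient.mk DoublyRootedNetwork.setoid N

/-- The classes of rooted networks whose ball of radius `r` around the root is isomorphic to
that of `N` by a root-preserving isomorphism moving conductances by less than `ε`. -/
def RootedNetwork.nbhd (N : RootedNetwork) (r : ℕ) (ε : ℝ) : Set RootedNetworkSpace :=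
  {g | ∃ N' : RootedNetwork, N'.toClass = g ∧
    ∃ φ : Network.BallIso N.toNetwork N.root N'.toNetwork N'.root r ε, φ.Sends N.root N'.root}

/-- The same for doubly rooted networks, with balls around the first root, for radii so large
that the second root is in the ball. -/
def DoublyRootedNetwork.nbhd (N : DoublyRootedNetwork) (r : ℕ) (ε : ℝ) :
    Set DoublyRootedNetworkSpace :=
  {g | ∃ N' : DoublyRootedNetwork, N'.toClass = g ∧
    ∃ φ : Network.BallIso N.toNetwork N.root₁ N'.toNetwork N'.root₁ r ε,
      φ.Sends N.root₁ N'.root₁ ∧ φ.Sends N.root₂ N'.root₂}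

/-- The local topology. -/
instance RootedNetworkSpace.topology : TopologicalSpace RootedNetworkSpace :=
  TopologicalSpace.generateFrom {U | ∃ (N : RootedNetwork) (r : ℕ) (ε : ℝ),
    0 < ε ∧ U = N.nbhd r ε}

/-- The local topology. -/
instance DoublyRootedNetworkSpace.topology : TopologicalSpace DoublyRootedNetworkSpace :=
  TopologicalSpace.generateFrom {U | ∃ (N : DoublyRootedNetwork) (r : ℕ) (ε : ℝ),
    0 < ε ∧ U = N.nbhd r ε}

instance RootedNetworkSpace.measurableSpace : MeasurableSpace RootedNetworkSpace :=
  borel RootedNetworkSpace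

instance DoublyRootedNetworkSpace.measurableSpace : MeasurableSpace DoublyRootedNetworkSpace :=
  borel DoublyRootedNetworkSpace

/-! ### Unimodularity -/

/-- The doubly rooted network `(G, c, u, v)`. -/
def Network.withRoots (N : Network) (u v : N.V) : DoublyRootedNetwork :=
  { N with root₁ := u, root₂ := v }

theorem Network.Iso.toClass_withRoots {N N' : Network} (φ : Network.Iso N N') (u v : N.V) :
    (N'.withRoots (φ.onV u) (φ.onV v)).toClass = (N.withRoots u v).toClass :=
  (Quotient.sound (s := DoublyRootedNetwork.setoid)
    (show (DoublyRootedNetwork.setoid).r _ _ from ⟨φ, rfl, rfl⟩)).symm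

/-- The total mass `∑_v f(G, c, ρ, v)` sent by the root. -/
def massOut (f : DoublyRootedNetworkSpace → ℝ≥0∞) : RootedNetworkSpace → ℝ≥0∞ :=
  Quotient.lift (fun N : RootedNetwork => ∑' v : N.V, f (N.withRoots N.root v).toClass) (by
    rintro N N' ⟨φ, h⟩
    rw [← φ.onV.tsum_eq, ← h]
    simp only [φ.toClass_withRoots])

/-- The total mass `∑_u f(G, c, u, ρ)` received by the root. -/
def massIn (f : DoublyRootedNetworkSpace → ℝ≥0∞) : RootedNetworkSpace → ℝ≥0∞ :=
  Quotient.lift (fun N : RootedNetwork => ∑' u : N.V, f (N.withRoots u N.root).toClass) (by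
    rintro N N' ⟨φ, h⟩
    rw [← φ.onV.tsum_eq, ← h]
    simp only [φ.toClass_withRoots])

/-- The Mass-Transport Principle for the random rooted network `G`: for every Borel function
`f ≥ 0` of doubly rooted networks, the expected mass sent by the root is equal to the expected
mass received by the root. -/
def IsUnimodular {Ω : Type*} [MeasurableSpace Ω] (P : Measure Ω)
    (G : Ω → RootedNetworkSpace) : Prop :=
  ∀ f : DoublyRootedNetworkSpace → ℝ≥0∞, Measurable f →
    ∫⁻ ω, massOut f (G ω) ∂P = ∫⁻ ω, massIn f (G ω) ∂P

end

/-! Write `p_n` for the heat kernel at the integer time `n`, and let `h(u)` be the probability that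
two independent walks from `u` survive and never collide at positive integer times. Let `u` send the
mass `h(u) * ∑ n, p_n(u,v)^2` to `v`.

Since `p_n` is symmetric, `ρ` receives `∑ n, ∑ u, p_n(ρ,u)^2 * h(u)`. The terms of this sum are
probabilities of the disjoint events that two walks from `ρ` collide for the last time at time `n`
and at `u`, so the sum is at most one (`tsum_lastCollision_le_one`, `massIn_collisionMass_le`). On
the other hand, `ρ` sends `h(ρ) * ∑ n, p_{2n}(ρ,ρ)`, where the sum is infinite by recurrence
(`Recurrent.tsum_heatKernel_even`). The Mass-Transport Principle therefore forces `h(ρ) = 0` almost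
surely, and positivity of `p_1` extends this to all pairs of distinct starting vertices
(`ae_iInf_noCollision_eq_zero`).

Consequently, for every fixed `s`, the walks collide at infinitely many of the times `s + n`
(`ae_frequently_eq`). By Fubini this holds almost surely for almost every `s`, and Borel–Cantelli
excludes a collision set of finite measure (`volume_eq_top_of_frequently_add_natCast_mem`).

The transported mass has to be Borel: decomposed by the number of jumps, the heat kernel is lower
semicontinuous under local limits by Fatou's lemma, so its superlevel sets are open. Explosion need
not be excluded, because only the bound `∑ v, p_t(u,v) ≤ 1` is used. -/

/-! ### Collisions of two independent chains with the same transition kernel -/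

section Kernel

variable {V : Type*} (p : V → V → ℝ≥0∞)

open Classical in
/-- For a sub-stochastic kernel `p`, the probability that two independent chains started from `x`
and `y` do not meet at any of the times `1, …, n` (and survive until then). -/
noncomputable def noCollision : ℕ → V → V → ℝ≥0∞
  | 0, _, _ => 1
  | n + 1, x, y => ∑' x', ∑' y', if x' = y' then 0 else p x x' * p y y' * noCollision n x' y'

variable {p}

theorem noCollision_le_one (hp : ∀ x, ∑' y, p x y ≤ 1) (n : ℕ) (x y : V) :
    noCollision p n x y ≤ 1 := by
  induction n generalizing x y with
  | zero => simp [noCollision]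
  | succ n ih =>
    calc noCollision p (n + 1) x y ≤ ∑' x', ∑' y', p x x' * p y y' := by
          refine ENNReal.tsum_le_tsum fun x' => ENNReal.tsum_le_tsum fun y' => ?_
          split_ifs
          · exact zero_le
          · exact mul_le_of_le_one_right zero_le (ih _ _)
      _ = (∑' x', p x x') * ∑' y', p y y' := by
          simp_rw [ENNReal.tsum_mul_left, ENNReal.tsum_mul_right]
      _ ≤ 1 := mul_le_one' (hp x) (hp y)

open Classical in
theorem mul_noCollision_le_succ {x y : V} (hxy : x ≠ y) (n : ℕ) (x₀ y₀ : V) :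
    p x₀ x * p y₀ y * noCollision p n x y ≤ noCollision p (n + 1) x₀ y₀ := by
  calc p x₀ x * p y₀ y * noCollision p n x y
      = (if x = y then 0 else p x₀ x * p y₀ y * noCollision p n x y) := by simp [hxy]
    _ ≤ ∑' y', (if x = y' then 0 else p x₀ x * p y₀ y' * noCollision p n x y') :=
        ENNReal.le_tsum (f := fun y' => if x = y' then 0 else p x₀ x * p y₀ y' *
          noCollision p n x y') y
    _ ≤ _ := ENNReal.le_tsum (f := fun x' => ∑' y', if x' = y' then 0 else
          p x₀ x' * p y₀ y' * noCollision p n x' y') x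

open Classical in
/-- The decomposition of the paths up to time `N` according to the time and the place of the last
collision. -/
theorem sum_lastCollision_le_one (hp : ∀ x, ∑' y, p x y ≤ 1) {q : ℕ → V → V → ℝ≥0∞}
    (q_zero : ∀ x y, q 0 x y = if x = y then 1 else 0)
    (q_succ : ∀ n x y, q (n + 1) x y = ∑' x', p x x' * q n x' y) (N : ℕ) (x y : V) :
    ∑ n ∈ Finset.range (N + 1), ∑' v, q n x v * q n y v * noCollision p (N - n) v v +
      (if x = y then 0 else noCollision p N x y) ≤ 1 := by
  have zero_term : ∀ (M : ℕ) (x y : V), ∑' v, q 0 x v * q 0 y v * noCollision p M v v =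
      if x = y then noCollision p M x y else 0 := by
    intro M x y
    rw [tsum_eq_single x]
    · by_cases h : x = y
      · subst h; simp [q_zero]
      · simp [q_zero, h, Ne.symm h]
    · intro v hv
      simp [q_zero, hv.symm]
  induction N generalizing x y with
  | zero =>
    simp only [zero_add, Finset.sum_range_one, Nat.sub_zero, zero_term]
    split_ifs <;> simp [noCollision]
  | succ N ih =>
    have succ_term : ∀ n ∈ Finset.range (N + 1),
        ∑' v, q (n + 1) x v * q (n + 1) y v * noCollision p (N + 1 - (n + 1)) v v =
        ∑' x', ∑' y', p x x' * p y y' *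
          ∑' v, q n x' v * q n y' v * noCollision p (N - n) v v := by
      intro n _
      simp_rw [Nat.add_sub_add_right, q_succ]
      have : ∀ v, (∑' x', p x x' * q n x' v) * (∑' y', p y y' * q n y' v) *
          noCollision p (N - n) v v = ∑' x', ∑' y', p x x' * p y y' *
            (q n x' v * q n y' v * noCollision p (N - n) v v) := by
        intro v
        rw [← ENNReal.tsum_mul_right, ← ENNReal.tsum_mul_right]
        refine tsum_congr fun x' => ?_
        rw [mul_assoc, ← ENNReal.tsum_mul_right, ← ENNReal.tsum_mul_left]
        exact tsum_congr fun y' => by ring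
      rw [tsum_congr this, ENNReal.tsum_comm]
      refine tsum_congr fun x' => ?_
      rw [ENNReal.tsum_comm]
      exact tsum_congr fun y' => ENNReal.tsum_mul_left
    -- The `n = 0` term and the residual term treat the complementary cases `x = y` and `x ≠ y`;
    -- together they make up `noCollision p (N + 1) x y`. Expanding it by the first step leaves the
    -- induction hypothesis at `(x', y')`.
    rw [Finset.sum_range_succ', Finset.sum_congr rfl succ_term, zero_term]
    rw [add_assoc, Nat.sub_zero]
    have : ((if x = y then noCollision p (N + 1) x y else 0) +
        if x = y then 0 else noCollision p (N + 1) x y) = noCollision p (N + 1) x y := by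
      split_ifs <;> simp
    rw [this, noCollision]
    rw [← Summable.tsum_finsetSum fun _ _ => ENNReal.summable, ← ENNReal.tsum_add]
    calc _ = ∑' x', ∑' y', p x x' * p y y' * (∑ n ∈ Finset.range (N + 1),
              ∑' v, q n x' v * q n y' v * noCollision p (N - n) v v +
                (if x' = y' then 0 else noCollision p N x' y')) := by
          refine tsum_congr fun x' => ?_
          rw [← Summable.tsum_finsetSum fun _ _ => ENNReal.summable, ← ENNReal.tsum_add]
          refine tsum_congr fun y' => ?_
          rw [mul_add, Finset.mul_sum]
          split_ifs <;> simp
      _ ≤ ∑' x', ∑' y', p x x' * p y y' :=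
          ENNReal.tsum_le_tsum fun x' => ENNReal.tsum_le_tsum fun y' =>
            mul_le_of_le_one_right zero_le (ih _ _)
      _ = (∑' x', p x x') * ∑' y', p y y' := by
          simp_rw [ENNReal.tsum_mul_left, ENNReal.tsum_mul_right]
      _ ≤ 1 := mul_le_one' (hp x) (hp y)

-- Both chains start at `x`, so the residual term is simply dropped, and each factor `noCollision p
-- (N - n) v v` is bounded below by the infimum, which no longer depends on `N`.
open Classical in
theorem tsum_lastCollision_le_one (hp : ∀ x, ∑' y, p x y ≤ 1) {q : ℕ → V → V → ℝ≥0∞}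
    (q_zero : ∀ x y, q 0 x y = if x = y then 1 else 0)
    (q_succ : ∀ n x y, q (n + 1) x y = ∑' x', p x x' * q n x' y) (x : V) :
    ∑' n, ∑' v, q n x v * q n x v * ⨅ k, noCollision p k v v ≤ 1 := by
  rw [ENNReal.tsum_eq_iSup_nat]
  refine iSup_le fun N => ?_
  refine le_trans ?_ (le_of_add_le_left (sum_lastCollision_le_one hp q_zero q_succ N x x))
  refine (Finset.sum_le_sum_of_subset (Finset.range_subset_range.2 N.le_succ)).trans ?_
  exact Finset.sum_le_sum fun n _ => ENNReal.tsum_le_tsum fun v => by gcongr; exact iInf_le _ _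

/-- Two chains from `ρ` move to `x` and `y` in one step with positive probability; if they could
then avoid each other forever, so could two chains from `ρ`. -/
theorem iInf_noCollision_eq_zero_of_root (hp : ∀ x, ∑' y, p x y ≤ 1)
    (hpos : ∀ x y, p x y ≠ 0) {ρ : V}
    (hρ : ⨅ k, noCollision p k ρ ρ = 0) {x y : V} (hxy : x ≠ y) :
    ⨅ k, noCollision p k x y = 0 := by
  have h : p ρ x * p ρ y * ⨅ k, noCollision p k x y ≤ 0 := by
    have hle : ∀ x y, p x y ≤ 1 := fun x y => (ENNReal.le_tsum y).trans (hp x)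
    rw [← hρ]
    refine le_iInf fun k => ?_
    rcases k with _ | k
    · exact mul_le_one' (mul_le_one' (hle _ _) (hle _ _)) (iInf_le _ 0)
    · exact (mul_le_mul_right (iInf_le _ k) _).trans (mul_noCollision_le_succ hxy k ρ ρ)
  simpa [hpos] using h

end Kernel

namespace Network

/-! ### Rates -/

section Rates

variable (N : Network)

instance instNonempty : Nonempty N.V := N.connected.nonempty

theorem totalRate_ne_top (u : N.V) : N.totalRate u ≠ ∞ := by
  have := (N.locallyFinite u).fintype
  have : Fintype {e : N.E // u ∈ N.ends e} := this
  rw [totalRate, tsum_fintype]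
  exact (ENNReal.sum_lt_top.2 fun _ _ => ENNReal.ofReal_lt_top).ne

theorem rate_comm (u v : N.V) : N.rate u v = N.rate v u := by
  unfold rate
  rw [Sym2.eq_swap]

theorem tsum_rate_le (u : N.V) : ∑' w, N.rate u w ≤ N.totalRate u := by
  unfold rate totalRate
  rw [← ENNReal.tsum_sigma' (fun p : Σ w, {e : N.E // N.ends e = s(u, w)} =>
    ENNReal.ofReal (N.cond p.2))]
  let f : (Σ w, {e : N.E // N.ends e = s(u, w)}) → {e : N.E // u ∈ N.ends e} :=
    fun p => ⟨p.2, by rw [p.2.2]; exact Sym2.mem_mk_left _ _⟩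
  have hf : Function.Injective f := by
    rintro ⟨w, e, he⟩ ⟨w', e', he'⟩ h
    obtain rfl : e = e' := congrArg Subtype.val h
    obtain rfl : w = w' := Sym2.congr_right.1 (he.symm.trans he')
    rfl
  exact ENNReal.tsum_comp_le_tsum_of_injective hf
    (fun e : {e : N.E // u ∈ N.ends e} => ENNReal.ofReal (N.cond e))

theorem rate_ne_zero_of_adj {u v : N.V} (h : N.simpleGraph.Adj u v) : N.rate u v ≠ 0 := by
  obtain ⟨⟨e, he⟩, -⟩ := (SimpleGraph.fromEdgeSet_adj _).1 h
  refine fun h0 => (ENNReal.ofReal_pos.2 (N.cond_pos e)).ne' ?_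
  exact ENNReal.tsum_eq_zero.1 h0 ⟨e, he⟩

theorem countable_walk_ends (n : ℕ) (u : N.V) :
    {v | ∃ p : N.simpleGraph.Walk u v, p.length = n}.Countable := by
  induction n generalizing u with
  | zero =>
    refine (Set.countable_singleton u).mono ?_
    rintro v ⟨p, hp⟩
    exact (SimpleGraph.Walk.eq_of_length_eq_zero hp).symm
  | succ n ih =>
    have hnbr : {w | N.simpleGraph.Adj u w}.Countable := by
      have : (⋃ e ∈ {e | u ∈ N.ends e}, {w | w ∈ N.ends e}).Countable := by
        refine (N.locallyFinite u).countable.biUnion fun e _ => ?_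
        induction N.ends e with
        | _ a b => exact (Set.toFinite {a, b}).countable.mono fun w hw => by simpa using hw
      refine this.mono fun w hw => ?_
      obtain ⟨⟨e, he⟩, -⟩ := (SimpleGraph.fromEdgeSet_adj _).1 hw
      simp only [Set.mem_iUnion]
      exact ⟨e, by simp [he], by simp [he]⟩
    refine (hnbr.biUnion fun w _ => ih w).mono ?_
    rintro v ⟨p, hp⟩
    cases p with
    | nil => simp at hp
    | cons h q => exact Set.mem_biUnion h ⟨q, by simpa using hp⟩

instance instCountable : Countable N.V := by
  obtain ⟨u⟩ := N.instNonempty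
  rw [← Set.countable_univ_iff]
  refine (Set.countable_iUnion fun n => N.countable_walk_ends n u).mono fun v _ => ?_
  obtain ⟨p⟩ := N.connected.preconnected u v
  exact Set.mem_iUnion.2 ⟨p.length, p, rfl⟩

end Rates

/-! ### The law of the walk according to the number of jumps -/

section Jumps

variable (N : Network)

open Classical in
/-- The probability that the walk stays at `u` up to time `t`, extended by `0` to `t < 0`. -/
noncomputable def holdProb (u : N.V) (t : ℝ) : ℝ≥0∞ :=
  if 0 ≤ t then ENNReal.ofReal (Real.exp (-((N.totalRate u).toReal * t))) else 0

open Classical in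
/-- The probability that the walk started from `u` is at `v` at time `t` after exactly `n` jumps,
extended by `0` to `t < 0`. -/
noncomputable def jumpKernel : ℕ → N.V → N.V → ℝ → ℝ≥0∞
  | 0, u, v => fun t => if u = v then N.holdProb u t else 0
  | n + 1, u, v => fun t => ∑' w, N.rate u w * (N.holdProb u ⋆ₗ jumpKernel n w v) t

@[fun_prop]
theorem measurable_holdProb (u : N.V) : Measurable (N.holdProb u) := by
  unfold holdProb
  exact Measurable.ite measurableSet_Ici (by fun_prop) measurable_const

@[fun_prop]
theorem measurable_jumpKernel (n : ℕ) (u v : N.V) : Measurable (N.jumpKernel n u v) := by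
  induction n generalizing u v with
  | zero =>
    by_cases h : u = v
    · simpa [jumpKernel, h] using N.measurable_holdProb v
    · simp [jumpKernel, h]
  | succ n ih =>
    exact Measurable.tsum fun w =>
      (measurable_lconvolution _ (N.measurable_holdProb u) (ih w v)).const_mul _

theorem holdProb_of_neg {u : N.V} {t : ℝ} (ht : t < 0) : N.holdProb u t = 0 := by
  simp [holdProb, ht]

theorem holdProb_of_nonneg {u : N.V} {t : ℝ} (ht : 0 ≤ t) :
    N.holdProb u t = ENNReal.ofReal (Real.exp (-((N.totalRate u).toReal * t))) := by
  simp [holdProb, ht]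

theorem holdProb_add {u : N.V} {s t : ℝ} (hs : 0 ≤ s) (ht : 0 ≤ t) :
    N.holdProb u (s + t) = N.holdProb u s * N.holdProb u t := by
  rw [N.holdProb_of_nonneg hs, N.holdProb_of_nonneg ht, N.holdProb_of_nonneg (add_nonneg hs ht),
    ← ENNReal.ofReal_mul (Real.exp_nonneg _), ← Real.exp_add]
  ring_nf

theorem jumpKernel_of_neg (n : ℕ) (u v : N.V) {t : ℝ} (ht : t < 0) :
    N.jumpKernel n u v t = 0 := by
  induction n generalizing u v t with
  | zero => simp [jumpKernel, N.holdProb_of_neg ht]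
  | succ n ih =>
    simp only [jumpKernel, lconvolution_def, ENNReal.tsum_eq_zero, mul_eq_zero]
    refine fun w => Or.inr ?_
    rw [lintegral_eq_zero_of_ae_eq_zero]
    refine Eventually.of_forall fun s => ?_
    rcases lt_or_ge s 0 with hs | hs
    · simp [N.holdProb_of_neg hs]
    · simp [ih w v (show -s + t < 0 by linarith)]

theorem tsum_lconvolution {ι : Type*} [Countable ι] {f : ι → ℝ → ℝ≥0∞} {g : ℝ → ℝ≥0∞}
    (hf : ∀ i, Measurable (f i)) (hg : Measurable g) (a : ι → ℝ≥0∞) :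
    (fun t => ∑' i, a i * f i t) ⋆ₗ g = fun t => ∑' i, a i * (f i ⋆ₗ g) t := by
  ext t
  simp only [lconvolution_def]
  simp_rw [← ENNReal.tsum_mul_right]
  rw [lintegral_tsum fun i => by fun_prop]
  refine tsum_congr fun i => ?_
  rw [← lintegral_const_mul _ (by fun_prop)]
  simp_rw [mul_assoc]

theorem lconvolution_tsum {ι : Type*} [Countable ι] {f : ι → ℝ → ℝ≥0∞} {g : ℝ → ℝ≥0∞}
    (hf : ∀ i, Measurable (f i)) (hg : Measurable g) (a : ι → ℝ≥0∞) :
    g ⋆ₗ (fun t => ∑' i, a i * f i t) = fun t => ∑' i, a i * (g ⋆ₗ f i) t := by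
  rw [lconvolution_comm, tsum_lconvolution hf hg]
  simp_rw [lconvolution_comm (g := g)]

/-- The forward equation. -/
theorem jumpKernel_succ' (n : ℕ) (u v : N.V) :
    N.jumpKernel (n + 1) u v =
      fun t => ∑' w, N.rate w v * (N.jumpKernel n u w ⋆ₗ N.holdProb v) t := by
  induction n generalizing u v with
  | zero =>
    ext t
    simp only [jumpKernel]
    rw [tsum_eq_single v, tsum_eq_single u]
    · simp
    · intro w hw
      simp [hw.symm, lconvolution_def]
    · intro w hw
      simp [hw, lconvolution_def]
  | succ n ih =>
    ext t
    -- One side peels off the first jump and then the last, the other the last and then the first;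
    -- associativity of convolution identifies them.
    have h1 : ∀ w, N.holdProb u ⋆ₗ N.jumpKernel (n + 1) w v = fun t => ∑' z, N.rate z v *
        (N.holdProb u ⋆ₗ (N.jumpKernel n w z ⋆ₗ N.holdProb v)) t := by
      intro w
      rw [ih, lconvolution_tsum (fun z => by fun_prop) (by fun_prop)]
    have h2 : ∀ z, N.jumpKernel (n + 1) u z ⋆ₗ N.holdProb v = fun t => ∑' w, N.rate u w *
        ((N.holdProb u ⋆ₗ N.jumpKernel n w z) ⋆ₗ N.holdProb v) t := by
      intro z
      rw [jumpKernel, tsum_lconvolution (fun z => by fun_prop) (by fun_prop)]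
    rw [jumpKernel]
    simp_rw [h1, h2, ← ENNReal.tsum_mul_left]
    rw [ENNReal.tsum_comm]
    refine tsum_congr fun z => tsum_congr fun w => ?_
    rw [lconvolution_assoc (by fun_prop) (by fun_prop) (by fun_prop)]
    ring

/-- Reversibility: since the rates are symmetric, the forward equation from `v` to `u` is the
backward recursion from `u` to `v`. -/
theorem jumpKernel_comm (n : ℕ) (u v : N.V) : N.jumpKernel n u v = N.jumpKernel n v u := by
  induction n generalizing u v with
  | zero =>
    ext t
    by_cases h : u = v
    · simp [h]
    · simp [jumpKernel, h, Ne.symm h]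
  | succ n ih =>
    rw [N.jumpKernel_succ' n v u, jumpKernel]
    ext t
    refine tsum_congr fun w => ?_
    rw [ih w v, lconvolution_comm, N.rate_comm u w]

theorem jumpKernel_succ_zero (n : ℕ) (u v : N.V) : N.jumpKernel (n + 1) u v 0 = 0 := by
  simp only [jumpKernel, lconvolution_def, ENNReal.tsum_eq_zero, mul_eq_zero]
  refine fun w => Or.inr ?_
  rw [lintegral_eq_zero_of_ae_eq_zero]
  have : ∀ᵐ s : ℝ, s ≠ 0 := by simp [ae_iff]
  filter_upwards [this] with s hs
  rcases lt_or_gt_of_ne hs with hs | hs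
  · simp [N.holdProb_of_neg hs]
  · simp [N.jumpKernel_of_neg n w v (neg_neg_of_pos hs)]

/-- As `holdProb` and `jumpKernel` vanish at negative times, the integral over `[0, t]` is a
convolution on the whole line. -/
theorem heatKernelAux_eq_sum (n : ℕ) {t : ℝ} (ht : 0 ≤ t) (u v : N.V) :
    N.heatKernelAux n t u v = ∑ k ∈ Finset.range n, N.jumpKernel k u v t := by
  induction n generalizing t u v with
  | zero => simp [heatKernelAux]
  | succ n ih =>
    rw [heatKernelAux, Finset.sum_range_succ', add_comm (Finset.sum _ _)]
    congr 1
    · simp [jumpKernel, N.holdProb_of_nonneg ht]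
    · have h1 : ∀ s, (Set.Icc 0 t).indicator (fun s => ENNReal.ofReal
          (Real.exp (-((N.totalRate u).toReal * s))) *
          ∑' w, N.rate u w * N.heatKernelAux n (t - s) w v) s =
          ∑ k ∈ Finset.range n, ∑' w, N.rate u w *
            (N.holdProb u s * N.jumpKernel k w v (-s + t)) := by
        intro s
        rcases lt_or_ge s 0 with hs | hs
        · simp [hs, N.holdProb_of_neg hs]
        rcases lt_or_ge t s with hst | hst
        · simp [hst, N.jumpKernel_of_neg _ _ _ (show -s + t < 0 by linarith)]
        · rw [Set.indicator_of_mem (show s ∈ Set.Icc 0 t from ⟨hs, hst⟩), ← N.holdProb_of_nonneg hs,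
            ← Summable.tsum_finsetSum fun _ _ => ENNReal.summable, ← ENNReal.tsum_mul_left]
          refine tsum_congr fun w => ?_
          rw [ih (sub_nonneg.2 hst), Finset.mul_sum, Finset.mul_sum, sub_eq_neg_add]
          exact Finset.sum_congr rfl fun k _ => by ring
      rw [← lintegral_indicator measurableSet_Icc]
      simp_rw [h1]
      rw [lintegral_finsetSum _ fun k _ => by fun_prop]
      refine Finset.sum_congr rfl fun k _ => ?_
      rw [lintegral_tsum fun w => by fun_prop]
      simp only [jumpKernel, lconvolution_def]
      exact tsum_congr fun w => lintegral_const_mul _ (by fun_prop)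

theorem heatKernel_eq_tsum {t : ℝ} (ht : 0 ≤ t) (u v : N.V) :
    N.heatKernel t u v = ∑' k, N.jumpKernel k u v t := by
  rw [heatKernel, ENNReal.tsum_eq_iSup_nat]
  exact iSup_congr fun n => N.heatKernelAux_eq_sum n ht u v

end Jumps

end Network

namespace Network

/-! ### Properties of the transition function -/

section Semigroup

variable (N : Network)

/-- Let `y` be the time of the first jump. If `y < t`, the induction hypothesis applies to the
remaining time `t - y`; if `y > t`, lack of memory splits off `holdProb u t` and the walk starts
afresh at time `t`. -/
theorem jumpKernel_add (n : ℕ) {s t : ℝ} (ht : 0 ≤ t) (hs : 0 ≤ s) (u v : N.V) :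
    N.jumpKernel n u v (t + s) = ∑ p ∈ Finset.HasAntidiagonal.antidiagonal n,
      ∑' z, N.jumpKernel p.1 u z t * N.jumpKernel p.2 z v s := by
  induction n generalizing t u v with
  | zero =>
    simp only [Finset.Nat.antidiagonal_zero, Finset.sum_singleton]
    rw [tsum_eq_single u]
    · by_cases h : u = v
      · subst h; simp [jumpKernel, N.holdProb_add ht hs]
      · simp [jumpKernel, h]
    · intro z hz
      simp [jumpKernel, hz.symm]
  | succ n ih =>
    have split : ∀ w, (N.holdProb u ⋆ₗ N.jumpKernel n w v) (t + s) =
        (∑ p ∈ Finset.HasAntidiagonal.antidiagonal n, ∑' z,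
          (N.holdProb u ⋆ₗ N.jumpKernel p.1 w z) t * N.jumpKernel p.2 z v s) +
        N.holdProb u t * (N.holdProb u ⋆ₗ N.jumpKernel n w v) s := by
      intro w
      have hae : ∀ᵐ y : ℝ, N.holdProb u y * N.jumpKernel n w v (-y + (t + s)) =
          (∑ p ∈ Finset.HasAntidiagonal.antidiagonal n, ∑' z,
            N.holdProb u y * N.jumpKernel p.1 w z (-y + t) * N.jumpKernel p.2 z v s) +
          N.holdProb u t * (N.holdProb u (y - t) * N.jumpKernel n w v (-(y - t) + s)) := by
        have : ∀ᵐ y : ℝ, y ≠ t := by simp [ae_iff]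
        filter_upwards [this] with y hy
        rcases lt_or_gt_of_ne hy with hy | hy
        · rw [N.holdProb_of_neg (show y - t < 0 by linarith), zero_mul, mul_zero, add_zero,
            show -y + (t + s) = (-y + t) + s by ring, ih (show 0 ≤ -y + t by linarith),
            Finset.mul_sum]
          refine Finset.sum_congr rfl fun p _ => ?_
          rw [← ENNReal.tsum_mul_left]
          simp_rw [mul_assoc]
        · have h0 : ∀ k z, N.jumpKernel k w z (-y + t) = 0 := fun k z =>
            N.jumpKernel_of_neg _ _ _ (by linarith)
          simp only [h0, mul_zero, zero_mul, tsum_zero, Finset.sum_const_zero, zero_add]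
          rw [← mul_assoc, ← N.holdProb_add ht (show 0 ≤ y - t by linarith)]
          ring_nf
      simp only [lconvolution_def]
      rw [lintegral_congr_ae hae, lintegral_add_left (by fun_prop),
        lintegral_finsetSum _ fun p _ => by fun_prop]
      congr 1
      · refine Finset.sum_congr rfl fun p _ => ?_
        rw [lintegral_tsum fun z => by fun_prop]
        exact tsum_congr fun z => lintegral_mul_const _ (by fun_prop)
      · rw [lintegral_const_mul _ (by fun_prop)]
        congr 1
        exact lintegral_sub_right_eq_self
          (fun y => N.holdProb u y * N.jumpKernel n w v (-y + s)) t
    rw [Finset.Nat.sum_antidiagonal_succ]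
    simp only [jumpKernel]
    simp_rw [split, mul_add]
    rw [ENNReal.tsum_add, add_comm]
    congr 1
    · refine Eq.symm ((tsum_eq_single u fun z hz => ?_).trans ?_)
      · simp [hz.symm]
      · rw [if_pos rfl, ← ENNReal.tsum_mul_left]
        exact tsum_congr fun w => by ring
    · simp_rw [Finset.mul_sum]
      rw [Summable.tsum_finsetSum fun _ _ => ENNReal.summable]
      refine Finset.sum_congr rfl fun p _ => ?_
      simp_rw [← ENNReal.tsum_mul_left, ← ENNReal.tsum_mul_right]
      rw [ENNReal.tsum_comm]
      exact tsum_congr fun z => tsum_congr fun w => by ring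

/-- The Chapman–Kolmogorov equation. -/
theorem heatKernel_add {s t : ℝ} (ht : 0 ≤ t) (hs : 0 ≤ s) (u v : N.V) :
    N.heatKernel (t + s) u v = ∑' z, N.heatKernel t u z * N.heatKernel s z v := by
  simp_rw [N.heatKernel_eq_tsum ht, N.heatKernel_eq_tsum hs,
    N.heatKernel_eq_tsum (add_nonneg ht hs), N.jumpKernel_add _ ht hs]
  have h1 : ∀ z, (∑' k, N.jumpKernel k u z t) * ∑' k, N.jumpKernel k z v s =
      ∑' p : ℕ × ℕ, N.jumpKernel p.1 u z t * N.jumpKernel p.2 z v s := by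
    intro z
    rw [ENNReal.tsum_prod (f := fun k l => N.jumpKernel k u z t * N.jumpKernel l z v s)]
    simp_rw [ENNReal.tsum_mul_left, ENNReal.tsum_mul_right]
  simp_rw [h1]
  rw [ENNReal.tsum_comm, ← Finset.HasAntidiagonal.sigmaAntidiagonalEquivProd.tsum_eq
    (fun p : ℕ × ℕ => ∑' z, N.jumpKernel p.1 u z t * N.jumpKernel p.2 z v s), ENNReal.tsum_sigma']
  refine tsum_congr fun n => ?_
  rw [← Finset.tsum_subtype]
  rfl

theorem heatKernel_comm {t : ℝ} (ht : 0 ≤ t) (u v : N.V) :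
    N.heatKernel t u v = N.heatKernel t v u := by
  simp_rw [N.heatKernel_eq_tsum ht, N.jumpKernel_comm _ u v]

open Classical in
theorem heatKernel_zero (u v : N.V) : N.heatKernel 0 u v = if u = v then 1 else 0 := by
  rw [N.heatKernel_eq_tsum le_rfl, tsum_eq_single 0]
  · simp [jumpKernel, holdProb]
  · intro n hn
    obtain ⟨m, rfl⟩ := Nat.exists_eq_succ_of_ne_zero hn
    exact N.jumpKernel_succ_zero m u v

theorem holdProb_le_heatKernel {t : ℝ} (ht : 0 ≤ t) (u : N.V) :
    N.holdProb u t ≤ N.heatKernel t u u := by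
  rw [N.heatKernel_eq_tsum ht]
  refine le_trans ?_ (ENNReal.le_tsum 0)
  simp [jumpKernel]

theorem holdProb_ne_zero {t : ℝ} (ht : 0 ≤ t) (u : N.V) : N.holdProb u t ≠ 0 := by
  rw [N.holdProb_of_nonneg ht]
  exact (ENNReal.ofReal_pos.2 (Real.exp_pos _)).ne'

theorem totalRate_mul_holdProb (u : N.V) (t : ℝ) :
    N.totalRate u * N.holdProb u t = exponentialPDF (N.totalRate u).toReal t := by
  rw [exponentialPDF_eq]
  rcases lt_or_ge t 0 with ht | ht
  · simp [N.holdProb_of_neg ht, ht.not_ge]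
  · rw [N.holdProb_of_nonneg ht, if_pos ht, ENNReal.ofReal_mul ENNReal.toReal_nonneg,
      ENNReal.ofReal_toReal (N.totalRate_ne_top u)]

/-- The walk either stays put up to time `t` or makes its first jump, at an exponential time, before
`t`. For `t < 0` the left side vanishes. -/
theorem holdProb_add_lintegral_le (u : N.V) (t : ℝ) :
    N.holdProb u t + ∫⁻ s in Set.Iic t, N.totalRate u * N.holdProb u s ≤ 1 := by
  rcases eq_or_ne (N.totalRate u) 0 with hu | hu
  · simp only [hu, zero_mul, lintegral_zero, add_zero, holdProb]
    split_ifs <;> simp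
  simp_rw [N.totalRate_mul_holdProb]
  rw [lintegral_exponentialPDF_eq_antiDeriv
    (ENNReal.toReal_pos hu (N.totalRate_ne_top u))]
  rcases lt_or_ge t 0 with ht | ht
  · simp [N.holdProb_of_neg ht, ht.not_ge]
  · rw [N.holdProb_of_nonneg ht, if_pos ht, ← ENNReal.ofReal_add (Real.exp_nonneg _)]
    · simp
    · have : 0 ≤ (N.totalRate u).toReal * t := mul_nonneg ENNReal.toReal_nonneg ht
      simpa using this

theorem lintegral_holdProb (u : N.V) : ∫⁻ t, N.holdProb u t = (N.totalRate u)⁻¹ := by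
  rcases eq_or_ne (N.totalRate u) 0 with hu | hu
  · have : N.holdProb u = (Set.Ici (0 : ℝ)).indicator 1 := by
      ext t
      by_cases ht : 0 ≤ t <;> simp [holdProb, hu, ht]
    rw [this, lintegral_indicator_one measurableSet_Ici, hu]
    simp
  · have h : N.totalRate u * ∫⁻ t, N.holdProb u t = 1 := by
      rw [← lintegral_const_mul _ (by fun_prop)]
      simp_rw [N.totalRate_mul_holdProb]
      exact lintegral_exponentialPDF_eq_one (ENNReal.toReal_pos hu (N.totalRate_ne_top u))
    exact (ENNReal.eq_inv_of_mul_eq_one_left (by rwa [mul_comm] at h))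

/-- Condition on the first jump: the mass after it is at most one by induction, so
`holdProb_add_lintegral_le` bounds the total. -/
theorem sum_tsum_jumpKernel_le (n : ℕ) (u : N.V) (t : ℝ) :
    ∑ k ∈ Finset.range n, ∑' v, N.jumpKernel k u v t ≤ 1 := by
  induction n generalizing u t with
  | zero => simp
  | succ n ih =>
    rw [Finset.sum_range_succ', add_comm]
    refine le_trans (add_le_add ?_ ?_) (N.holdProb_add_lintegral_le u t)
    · rw [tsum_eq_single u]
      · simp [jumpKernel]
      · intro z hz
        simp [jumpKernel, hz.symm]
    calc ∑ k ∈ Finset.range n, ∑' v, N.jumpKernel (k + 1) u v t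
        = ∫⁻ s, N.holdProb u s * ∑' w, N.rate u w *
            ∑ k ∈ Finset.range n, ∑' v, N.jumpKernel k w v (-s + t) := by
          simp_rw [Finset.mul_sum, ← ENNReal.tsum_mul_left]
          rw [lintegral_tsum fun w => by fun_prop]
          simp_rw [Finset.mul_sum, ← ENNReal.tsum_mul_left]
          simp only [jumpKernel, lconvolution_def]
          have : ∀ k ∈ Finset.range n, ∑' v, ∑' w, N.rate u w *
              ∫⁻ s, N.holdProb u s * N.jumpKernel k w v (-s + t) = ∑' w, ∑' v,
              ∫⁻ s, N.holdProb u s * (N.rate u w * N.jumpKernel k w v (-s + t)) := by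
            intro k _
            rw [ENNReal.tsum_comm]
            refine tsum_congr fun w => tsum_congr fun v => ?_
            rw [← lintegral_const_mul _ (by fun_prop)]
            exact lintegral_congr fun s => by ring
          rw [Finset.sum_congr rfl this, ← Summable.tsum_finsetSum fun _ _ => ENNReal.summable]
          refine tsum_congr fun w => ?_
          rw [lintegral_finsetSum _ fun k _ => by fun_prop]
          refine Finset.sum_congr rfl fun k _ => ?_
          rw [lintegral_tsum fun v => by fun_prop]
      _ ≤ ∫⁻ s, (Set.Iic t).indicator (fun s => N.totalRate u * N.holdProb u s) s := by
          refine lintegral_mono fun s => ?_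
          rcases le_or_gt s t with hs | hs
          · rw [Set.indicator_of_mem (show s ∈ Set.Iic t from hs), mul_comm (N.totalRate u)]
            gcongr
            refine le_trans ?_ (N.tsum_rate_le u)
            exact ENNReal.tsum_le_tsum fun w => mul_le_of_le_one_right zero_le (ih w _)
          · simp [N.jumpKernel_of_neg _ _ _ (show -s + t < 0 by linarith)]
      _ = _ := lintegral_indicator measurableSet_Iic _

theorem tsum_heatKernel_le {t : ℝ} (ht : 0 ≤ t) (u : N.V) : ∑' v, N.heatKernel t u v ≤ 1 := by
  simp_rw [N.heatKernel_eq_tsum ht]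
  rw [ENNReal.tsum_comm, ENNReal.tsum_eq_iSup_nat]
  exact iSup_le fun n => N.sum_tsum_jumpKernel_le n u t

theorem heatKernel_mul_le {s t : ℝ} (ht : 0 ≤ t) (hs : 0 ≤ s) (u z v : N.V) :
    N.heatKernel t u z * N.heatKernel s z v ≤ N.heatKernel (t + s) u v := by
  rw [N.heatKernel_add ht hs]
  exact ENNReal.le_tsum (f := fun z => N.heatKernel t u z * N.heatKernel s z v) z

theorem heatKernel_ne_zero_of_adj {u v : N.V} (h : N.simpleGraph.Adj u v) {t : ℝ} (ht : 0 < t) :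
    N.heatKernel t u v ≠ 0 := by
  have h1 : N.jumpKernel 1 u v t ≠ 0 := by
    refine fun h0 => ?_
    simp only [jumpKernel, ENNReal.tsum_eq_zero] at h0
    have h2 := h0 v
    simp only [if_true, mul_eq_zero, N.rate_ne_zero_of_adj h, false_or, lconvolution_def] at h2
    rw [lintegral_eq_zero_iff (by fun_prop)] at h2
    have h3 : (volume : Measure ℝ) (Set.Ioo 0 t) = 0 := by
      refine measure_mono_null (fun s hs => ?_) (ae_iff.1 h2)
      simp only [Set.mem_ofPred_eq, Pi.zero_apply, mul_eq_zero, not_or]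
      exact ⟨N.holdProb_ne_zero hs.1.le _, N.holdProb_ne_zero (by linarith [hs.2]) _⟩
    simp only [Real.volume_Ioo, sub_zero, ENNReal.ofReal_eq_zero] at h3
    linarith
  rw [N.heatKernel_eq_tsum ht.le]
  exact fun h0 => h1 (ENNReal.tsum_eq_zero.1 h0 1)

theorem heatKernel_ne_zero {t : ℝ} (ht : 0 < t) (u v : N.V) : N.heatKernel t u v ≠ 0 := by
  obtain ⟨p⟩ := N.connected.preconnected u v
  induction p generalizing t with
  | nil =>
    exact fun h0 => N.holdProb_ne_zero ht.le _
      (le_zero_iff.1 (h0 ▸ N.holdProb_le_heatKernel ht.le _))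
  | cons h q ih =>
    intro h0
    rename_i u w v
    have := N.heatKernel_mul_le (half_pos ht).le (half_pos ht).le u w v
    rw [add_halves, h0, le_zero_iff, mul_eq_zero] at this
    exact this.elim (N.heatKernel_ne_zero_of_adj h (half_pos ht)) (ih (half_pos ht))

end Semigroup

/-! ### Recurrence -/

section Recurrence

variable (N : Network)

/-- The expected total time which the walk started from `u` spends at `v`. -/
noncomputable def greenFunction (u v : N.V) : ℝ≥0∞ :=
  ∑' n, ∫⁻ t, N.jumpKernel n u v t

theorem lintegral_lconvolution {f g : ℝ → ℝ≥0∞} (hf : Measurable f) (hg : Measurable g) :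
    ∫⁻ t, (f ⋆ₗ g) t = (∫⁻ t, f t) * ∫⁻ t, g t := by
  simp only [lconvolution_def]
  rw [lintegral_lintegral_swap (by fun_prop), ← lintegral_mul_const _ hf]
  refine lintegral_congr fun s => ?_
  rw [lintegral_const_mul _ (by fun_prop), lintegral_add_left_eq_self g (-s)]

open Classical in
theorem greenFunction_eq (u v : N.V) : N.greenFunction u v =
    (if u = v then (N.totalRate u)⁻¹ else 0) +
      ∑' w, N.rate u w / N.totalRate u * N.greenFunction w v := by
  have h0 : ∫⁻ t, N.jumpKernel 0 u v t = if u = v then (N.totalRate u)⁻¹ else 0 := by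
    by_cases h : u = v
    · simp [jumpKernel, h, N.lintegral_holdProb]
    · simp [jumpKernel, h]
  have h1 : ∀ n, ∫⁻ t, N.jumpKernel (n + 1) u v t =
      ∑' w, N.rate u w / N.totalRate u * ∫⁻ t, N.jumpKernel n w v t := by
    intro n
    simp only [jumpKernel]
    rw [lintegral_tsum fun w =>
      ((measurable_lconvolution _ (by fun_prop) (by fun_prop)).const_mul _).aemeasurable]
    refine tsum_congr fun w => ?_
    rw [lintegral_const_mul _ (measurable_lconvolution _ (by fun_prop) (by fun_prop)),
      lintegral_lconvolution (by fun_prop) (by fun_prop), N.lintegral_holdProb, div_eq_mul_inv,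
      mul_assoc]
  rw [greenFunction, tsum_eq_zero_add' ENNReal.summable, h0]
  simp_rw [h1]
  rw [ENNReal.tsum_comm]
  simp_rw [ENNReal.tsum_mul_left, greenFunction]

/-- Truncated form of the decomposition at the first positive visit to `v`, obtained from
`greenFunction_eq` alone, without a strong Markov property. -/
theorem sum_firstVisitProb_mul_le (hN : ∀ u, N.totalRate u ≠ 0) (v : N.V) (m : ℕ) (u : N.V) :
    (∑ n ∈ Finset.range m, N.firstVisitProb v n u) * N.greenFunction v v ≤
      ∑' w, N.rate u w / N.totalRate u * N.greenFunction w v := by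
  classical
  induction m generalizing u with
  | zero => simp
  | succ m ih =>
    have h1 : ∀ w, (∑ n ∈ Finset.range m, N.firstVisitProb v n w) * N.greenFunction v v ≤
        N.greenFunction w v := fun w =>
      (ih w).trans (by rw [N.greenFunction_eq w v]; exact le_add_self)
    have h2 : ∑ n ∈ Finset.range (m + 1), N.firstVisitProb v n u = ∑' w, N.stepProb u w *
        (if w = v then 1 else ∑ n ∈ Finset.range m, N.firstVisitProb v n w) := by
      rw [Finset.sum_range_succ', add_comm]
      simp only [firstVisitProb]
      rw [← Summable.tsum_finsetSum fun _ _ => ENNReal.summable]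
      have : N.stepProb u v = ∑' w, if w = v then N.stepProb u w else 0 := by
        rw [tsum_ite_eq]
      rw [this, ← ENNReal.tsum_add]
      refine tsum_congr fun w => ?_
      split_ifs <;> simp [Finset.mul_sum]
    rw [h2, ← ENNReal.tsum_mul_right]
    refine ENNReal.tsum_le_tsum fun w => ?_
    rw [stepProb, if_neg (hN u), mul_assoc]
    gcongr
    split_ifs with h
    · rw [h, one_mul]
    · exact h1 w

/-- With return probability one, `greenFunction_eq` yields `1 / c(v) + g ≤ g` for `g = greenFunction
v v`, impossible for finite `g` because `c(v) < ∞`. -/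
theorem Recurrent.greenFunction_self {N : Network} (hN : N.Recurrent) (v : N.V) :
    N.greenFunction v v = ∞ := by
  -- A vertex without edges is the whole network by connectedness; there the convention `0⁻¹ = ∞`
  -- gives the infinite value directly.
  by_cases h0 : ∃ u, N.totalRate u = 0
  · obtain ⟨u, hu⟩ := h0
    have hv : N.totalRate v = 0 := by
      rcases eq_or_ne v u with rfl | hvu
      · exact hu
      · obtain ⟨p⟩ := N.connected.preconnected u v
        cases p with
        | nil => exact hu
        | @cons _ w _ h q =>
          refine absurd ?_ (N.rate_ne_zero_of_adj h)
          exact le_zero_iff.1 (hu ▸ (ENNReal.le_tsum w).trans (N.tsum_rate_le u))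
    rw [N.greenFunction_eq]
    simp [hv]
  · push Not at h0
    have h1 : N.greenFunction v v ≤
        ∑' w, N.rate v w / N.totalRate v * N.greenFunction w v := by
      conv_lhs => rw [← one_mul (N.greenFunction v v), ← hN v, ENNReal.tsum_eq_iSup_nat,
        ENNReal.iSup_mul]
      exact iSup_le fun m => N.sum_firstVisitProb_mul_le h0 v m v
    by_contra htop
    have h2 := N.greenFunction_eq v v
    rw [if_pos rfl] at h2
    have h3 : (N.totalRate v)⁻¹ + N.greenFunction v v ≤ 0 + N.greenFunction v v := by
      rw [zero_add]
      exact (add_le_add_right h1 _).trans_eq h2.symm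
    have h4 := (ENNReal.add_le_add_iff_right htop).1 h3
    simp [N.totalRate_ne_top] at h4

theorem Recurrent.tsum_heatKernel_even {N : Network} (hN : N.Recurrent) (v : N.V) :
    ∑' n : ℕ, N.heatKernel (n + n) v v = ∞ := by
  let F : ℝ → ℝ≥0∞ := fun t => ∑' k, N.jumpKernel k v v t
  have hF : ∫⁻ t, F t = ∞ := by
    rw [← hN.greenFunction_self v, greenFunction, lintegral_tsum fun k => by fun_prop]
  -- From a time `t` in the window, waiting at `v` for the remaining `2n + 2 - t ≤ 2` has
  -- probability at least `holdProb v 2`. The factor `2` on the right is the length of the window.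
  have hle : ∀ n : ℕ, N.holdProb v 2 * ∫⁻ t in Set.Ioc (n + n : ℝ) (n + n + 2), F t ≤
      2 * N.heatKernel ((n + 1 : ℕ) + (n + 1 : ℕ)) v v := by
    intro n
    rw [← lintegral_const_mul _ (by fun_prop)]
    calc ∫⁻ t in Set.Ioc (n + n : ℝ) (n + n + 2), N.holdProb v 2 * F t
        ≤ ∫⁻ t in Set.Ioc (n + n : ℝ) (n + n + 2),
            N.heatKernel ((n + 1 : ℕ) + (n + 1 : ℕ)) v v := by
          refine setLIntegral_mono measurable_const fun t ht => ?_
          have hn : (0 : ℝ) ≤ n := n.cast_nonneg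
          have ht0 : 0 ≤ t := by linarith [ht.1]
          have hs0 : 0 ≤ n + n + 2 - t := by linarith [ht.2]
          have : ((n + 1 : ℕ) + (n + 1 : ℕ) : ℝ) = (n + n + 2 - t) + t := by push_cast; ring
          rw [this]
          refine le_trans ?_ (N.heatKernel_mul_le hs0 ht0 v v v)
          rw [N.heatKernel_eq_tsum ht0]
          refine mul_le_mul_left (le_trans ?_ (N.holdProb_le_heatKernel hs0 v)) _
          rw [N.holdProb_of_nonneg zero_le_two, N.holdProb_of_nonneg hs0]
          gcongr
          linarith [ht.1]
      _ = _ := by simp [mul_comm]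
  have hcover : ∫⁻ t, F t ≤ ∑' n : ℕ, ∫⁻ t in Set.Ioc (n + n : ℝ) (n + n + 2), F t := by
    refine le_trans ?_ (lintegral_iUnion_le _ _)
    rw [← lintegral_indicator (MeasurableSet.iUnion fun _ => measurableSet_Ioc)]
    refine lintegral_mono_ae ?_
    have : ∀ᵐ t : ℝ, t ≠ 0 := by simp [ae_iff]
    filter_upwards [this] with t ht
    rcases lt_or_gt_of_ne ht with ht | ht
    · simp [F, N.jumpKernel_of_neg _ _ _ ht]
    · rw [Set.indicator_of_mem]
      rw [Set.mem_iUnion]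
      have h1 := Nat.ceil_lt_add_one (half_pos ht).le
      have h2 := Nat.le_ceil (t / 2)
      have h3 : 0 < ⌈t / 2⌉₊ := Nat.ceil_pos.2 (half_pos ht)
      obtain ⟨m, hm⟩ := Nat.exists_eq_succ_of_ne_zero h3.ne'
      rw [hm] at h1 h2
      push_cast at h1 h2
      exact ⟨m, by linarith, by linarith⟩
  have h1 : N.holdProb v 2 * ∞ ≤ 2 * ∑' n : ℕ, N.heatKernel ((n + 1 : ℕ) + (n + 1 : ℕ)) v v := by
    rw [← hF, ← ENNReal.tsum_mul_left]
    refine (mul_le_mul_right hcover _).trans ?_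
    rw [← ENNReal.tsum_mul_left]
    exact ENNReal.tsum_le_tsum hle
  rw [ENNReal.mul_top (N.holdProb_ne_zero zero_le_two v), top_le_iff, ENNReal.mul_eq_top] at h1
  rw [tsum_eq_zero_add' ENNReal.summable]
  rcases h1 with h1 | h1
  · rw [h1.2, add_top]
  · simp at h1

end Recurrence

end Network

/-! ### Lower semicontinuity with respect to local limits -/

theorem ENNReal.sum_le_liminf_sum {ι : Type*} (s : Finset ι) {g : ι → ℝ≥0∞} {g' : ℕ → ι → ℝ≥0∞}
    (h : ∀ i, g i ≤ liminf (fun k => g' k i) atTop) :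
    ∑ i ∈ s, g i ≤ liminf (fun k => ∑ i ∈ s, g' k i) atTop := by
  let : MeasurableSpace ι := ⊤
  have h1 := lintegral_liminf_le (μ := Measure.count.restrict (s : Set ι)) (u := atTop) (f := g')
    fun k => measurable_from_top
  simp only [lintegral_finset, Measure.count_singleton, mul_one] at h1
  exact (Finset.sum_le_sum fun i _ => h i).trans h1

/-- Fatou's lemma on finite partial sums: on each finite set of indices `φ k` is eventually
injective, so no term of the target sum is counted twice. -/
theorem ENNReal.tsum_le_liminf_tsum {ι : Type*} {κ : ℕ → Type*} {φ : ∀ k, ι → κ k}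
    (hφ : ∀ i j, i ≠ j → ∀ᶠ k in atTop, φ k i ≠ φ k j) {g : ι → ℝ≥0∞} {g' : ∀ k, κ k → ℝ≥0∞}
    (h : ∀ i, g i ≤ liminf (fun k => g' k (φ k i)) atTop) :
    ∑' i, g i ≤ liminf (fun k => ∑' j, g' k j) atTop := by
  classical
  rw [ENNReal.tsum_eq_iSup_sum]
  refine iSup_le fun s => (ENNReal.sum_le_liminf_sum s h).trans (liminf_le_liminf ?_)
  have hinj : ∀ᶠ k in atTop, ∀ i ∈ s, ∀ j ∈ s, i ≠ j → φ k i ≠ φ k j := by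
    simp only [Filter.eventually_all_finset]
    exact fun i _ j _ => by
      by_cases hij : i = j
      · simp [hij]
      · simpa [hij] using hφ i j hij
  filter_upwards [hinj] with k hk
  have hk' : Set.InjOn (φ k) s := fun i hi j hj hij => by
    by_contra hne
    exact hk i hi j hj hne hij
  rw [← Finset.sum_image (f := g' k) hk']
  exact ENNReal.sum_le_tsum _

theorem ENNReal.mul_le_liminf_mul {a b : ℝ≥0∞} {a' b' : ℕ → ℝ≥0∞}
    (ha : a ≤ liminf a' atTop) (hb : b ≤ liminf b' atTop) :
    a * b ≤ liminf (fun k => a' k * b' k) atTop :=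
  (mul_le_mul' ha hb).trans ENNReal.le_liminf_mul

namespace Network

/-- The maps `φ k` exhibit the network `N` as a local limit of the networks `M k`. -/
structure IsLocalLimit (N : Network) (M : ℕ → Network) (φ : ∀ k, N.V → (M k).V) : Prop where
  ne : ∀ u v, u ≠ v → ∀ᶠ k in atTop, φ k u ≠ φ k v
  rate_le : ∀ u v, N.rate u v ≤ liminf (fun k => (M k).rate (φ k u) (φ k v)) atTop
  tendsto_totalRate : ∀ u, Tendsto (fun k => (M k).totalRate (φ k u)) atTop (𝓝 (N.totalRate u))

namespace IsLocalLimit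

variable {N : Network} {M : ℕ → Network} {φ : ∀ k, N.V → (M k).V}

/-- The holding probability decreases in the total rate; this is why a local limit demands
convergence of `totalRate`, whereas a lower bound suffices for `rate`. -/
theorem holdProb_le (h : IsLocalLimit N M φ) (u : N.V) (t : ℝ) :
    N.holdProb u t ≤ liminf (fun k => (M k).holdProb (φ k u) t) atTop := by
  refine (Tendsto.liminf_eq ?_).ge
  unfold holdProb
  split_ifs
  · refine ENNReal.tendsto_ofReal ((Real.continuous_exp.tendsto _).comp ?_)
    exact (((ENNReal.tendsto_toReal (N.totalRate_ne_top u)).comp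
      (h.tendsto_totalRate u)).mul_const t).neg
  · exact tendsto_const_nhds

/-- Fatou's lemma is applied both to the sum over the target of the first jump and to the integral
over its time. -/
theorem jumpKernel_le (h : IsLocalLimit N M φ) (n : ℕ) (u v : N.V) (t : ℝ) :
    N.jumpKernel n u v t ≤ liminf (fun k => (M k).jumpKernel n (φ k u) (φ k v) t) atTop := by
  induction n generalizing u v t with
  | zero =>
    by_cases huv : u = v
    · simpa [jumpKernel, huv] using h.holdProb_le v t
    · simp [jumpKernel, huv]
  | succ n ih =>
    refine ENNReal.tsum_le_liminf_tsum h.ne fun w =>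
      ENNReal.mul_le_liminf_mul (h.rate_le u w) ?_
    simp only [lconvolution_def]
    refine le_trans (lintegral_mono fun s => ?_) (lintegral_liminf_le fun k => by fun_prop)
    exact ENNReal.mul_le_liminf_mul (h.holdProb_le u s) (ih w v _)

theorem heatKernel_le (h : IsLocalLimit N M φ) {t : ℝ} (ht : 0 ≤ t) (u v : N.V) :
    N.heatKernel t u v ≤ liminf (fun k => (M k).heatKernel t (φ k u) (φ k v)) atTop := by
  simp_rw [heatKernel_eq_tsum _ ht]
  exact ENNReal.tsum_le_liminf_tsum (φ := fun _ => id)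
    (fun i j hij => Eventually.of_forall fun _ => hij) fun n => h.jumpKernel_le n u v t

theorem noCollision_le (h : IsLocalLimit N M φ) (n : ℕ) (u v : N.V) :
    noCollision (N.heatKernel 1) n u v ≤
      liminf (fun k => noCollision ((M k).heatKernel 1) n (φ k u) (φ k v)) atTop := by
  induction n generalizing u v with
  | zero => simp [noCollision]
  | succ n ih =>
    refine ENNReal.tsum_le_liminf_tsum h.ne fun u' => ENNReal.tsum_le_liminf_tsum h.ne fun v' => ?_
    split_ifs with huv
    · exact zero_le
    · refine (ENNReal.mul_le_liminf_mul (ENNReal.mul_le_liminf_mul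
        (h.heatKernel_le zero_le_one u u') (h.heatKernel_le zero_le_one v v')) (ih u' v')).trans ?_
      refine liminf_le_liminf ?_
      filter_upwards [h.ne u' v' huv] with k hk
      rw [if_neg hk]

end IsLocalLimit

namespace Iso

variable {N N' : Network} (φ : Iso N N')

theorem rate_eq (u v : N.V) : N'.rate (φ.onV u) (φ.onV v) = N.rate u v := by
  have h : ∀ e, N.ends e = s(u, v) ↔ N'.ends (φ.onE e) = s(φ.onV u, φ.onV v) := by
    intro e
    rw [φ.map_ends, ← Sym2.map_mk, (Sym2.map.injective φ.onV.injective).eq_iff]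
  rw [rate, rate, ← (φ.onE.subtypeEquiv h).tsum_eq]
  exact tsum_congr fun e => by simp [φ.map_cond]

theorem totalRate_eq (u : N.V) : N'.totalRate (φ.onV u) = N.totalRate u := by
  have h : ∀ e, u ∈ N.ends e ↔ φ.onV u ∈ N'.ends (φ.onE e) := by
    intro e
    rw [φ.map_ends, Sym2.mem_map]
    simp
  rw [totalRate, totalRate, ← (φ.onE.subtypeEquiv h).tsum_eq]
  exact tsum_congr fun e => by simp [φ.map_cond]

theorem isLocalLimit : IsLocalLimit N (fun _ => N') (fun _ => φ.onV) where
  ne u v huv := Eventually.of_forall fun _ => φ.onV.injective.ne huv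
  rate_le u v := by simp [φ.rate_eq]
  tendsto_totalRate u := by simp [φ.totalRate_eq]

end Iso

/-! ### Isomorphisms of growing balls produce local limits -/

theorem mem_ballEdges (N : Network) {x u : N.V} {r : ℕ} (hu : N.simpleGraph.dist x u < r) {e : N.E}
    (he : u ∈ N.ends e) : e ∈ N.ballEdges x r := by
  intro v hv
  rcases eq_or_ne u v with rfl | huv
  · exact hu.le
  · have hadj : N.simpleGraph.Adj u v :=
      (SimpleGraph.fromEdgeSet_adj _).2 ⟨⟨e, (Sym2.mem_and_mem_iff huv).1 ⟨he, hv⟩⟩, huv⟩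
    have h1 : N.simpleGraph.dist x v ≤ N.simpleGraph.dist x u + N.simpleGraph.dist u v :=
      SimpleGraph.Connected.dist_triangle N.connected
    rw [SimpleGraph.dist_eq_one_iff_adj.2 hadj] at h1
    exact h1.trans hu

namespace BallIso

variable {N : Network} {x : N.V} {N' : Network} {x' : N'.V} {r : ℕ} {ε : ℝ}
  (ψ : BallIso N x N' x' r ε)

open Classical in
/-- The vertex map of an isomorphism of balls, extended by a constant. -/
noncomputable def vertexMap (v : N.V) : N'.V :=
  if h : v ∈ N.ball x r then ψ.onV ⟨v, h⟩ else x'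

theorem vertexMap_of_mem {v : N.V} (h : v ∈ N.ball x r) : ψ.vertexMap v = ψ.onV ⟨v, h⟩ :=
  dif_pos h

theorem vertexMap_injOn : Set.InjOn ψ.vertexMap (N.ball x r) := by
  intro u hu v hv h
  rw [ψ.vertexMap_of_mem hu, ψ.vertexMap_of_mem hv] at h
  exact congrArg Subtype.val (ψ.onV.injective (Subtype.ext h))

theorem Sends.vertexMap_eq {ψ : BallIso N x N' x' r ε} {y : N.V} {y' : N'.V} (h : ψ.Sends y y') :
    ψ.vertexMap y = y' := by
  obtain ⟨v, rfl, hv⟩ := h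
  rw [ψ.vertexMap_of_mem v.2, ← hv]

theorem mem_ends_onE {v : N.V} (hv : v ∈ N.ball x r) (e : N.ballEdges x r) :
    ψ.vertexMap v ∈ N'.ends (ψ.onE e) ↔ v ∈ N.ends e := by
  rw [ψ.vertexMap_of_mem hv]
  exact (ψ.mem_ends e ⟨v, hv⟩).symm

/-- An unordered pair is determined by its members, even for a loop, and every end of the image edge
lies in the image ball, hence comes from a vertex of the first ball. -/
theorem ends_onE {u v : N.V} (hu : u ∈ N.ball x r) (hv : v ∈ N.ball x r) (e : N.ballEdges x r)
    (he : N.ends e = s(u, v)) : N'.ends (ψ.onE e) = s(ψ.vertexMap u, ψ.vertexMap v) := by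
  have hmem : ∀ w ∈ N.ball x r, ψ.vertexMap w ∈ N'.ends (ψ.onE e) ↔ w = u ∨ w = v := by
    intro w hw
    rw [ψ.mem_ends_onE hw, he, Sym2.mem_iff]
  refine Sym2.ext fun z => ⟨fun hz => ?_, fun hz => ?_⟩
  · obtain ⟨w, hw⟩ := ψ.onV.surjective ⟨z, (ψ.onE e).2 z hz⟩
    have hwz : ψ.vertexMap w = z := by rw [ψ.vertexMap_of_mem w.2, hw]
    rw [← hwz, hmem w w.2] at hz
    rw [← hwz]
    rcases hz with hz | hz <;> simp [hz]
  · rcases Sym2.mem_iff.1 hz with rfl | rfl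
    · exact (hmem u hu).2 (Or.inl rfl)
    · exact (hmem v hv).2 (Or.inr rfl)

/-- A walk of length at most `r` to the centre stays in the ball, so its image is a walk. Hence
interior vertices go to interior vertices, where no edge is cut off by the ball. -/
theorem dist_vertexMap_le (hψ : ψ.Sends x x') {v : N.V} (p : N.simpleGraph.Walk v x)
    (hp : p.length ≤ r) : N'.simpleGraph.dist x' (ψ.vertexMap v) ≤ p.length := by
  induction p with
  | nil => simp [hψ.vertexMap_eq]
  | @cons v w x h q ih =>
    have hq : q.length < r := by simpa using hp
    have hv : v ∈ N.ball x r := by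
      have := SimpleGraph.dist_le (SimpleGraph.Walk.cons h q)
      rw [SimpleGraph.dist_comm] at this
      exact this.trans hp
    have hw : w ∈ N.ball x r := by
      have := SimpleGraph.dist_le q
      rw [SimpleGraph.dist_comm] at this
      exact this.trans hq.le
    obtain ⟨⟨e, he⟩, hne⟩ := (SimpleGraph.fromEdgeSet_adj _).1 h
    have heb : e ∈ N.ballEdges x r := by
      intro z hz
      rw [he, Sym2.mem_iff] at hz
      rcases hz with rfl | rfl
      · exact hv
      · exact hw
    have hadj : N'.simpleGraph.Adj (ψ.vertexMap w) (ψ.vertexMap v) :=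
      (SimpleGraph.fromEdgeSet_adj _).2 ⟨⟨_, ψ.ends_onE hw hv ⟨e, heb⟩ (he.trans Sym2.eq_swap)⟩,
        fun hwv => hne (ψ.vertexMap_injOn hv hw hwv.symm)⟩
    have h1 : N'.simpleGraph.dist x' (ψ.vertexMap v) ≤ N'.simpleGraph.dist x' (ψ.vertexMap w) +
        N'.simpleGraph.dist (ψ.vertexMap w) (ψ.vertexMap v) :=
      SimpleGraph.Connected.dist_triangle N'.connected
    rw [SimpleGraph.dist_eq_one_iff_adj.2 hadj] at h1
    rw [SimpleGraph.Walk.length_cons]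
    exact h1.trans (Nat.add_le_add_right (ih ψ hψ hq.le) 1)

/-- The bijection between the edges at an interior vertex of the ball and those at its image. -/
def edgesAtEquiv (hψ : ψ.Sends x x') {u : N.V} (hu : N.simpleGraph.dist x u < r) :
    {e : N.E // u ∈ N.ends e} ≃ {e : N'.E // ψ.vertexMap u ∈ N'.ends e} :=
  have hu' : N'.simpleGraph.dist x' (ψ.vertexMap u) < r := by
    obtain ⟨p, hp⟩ := SimpleGraph.Connected.exists_walk_length_eq_dist N.connected u x
    have hp' : p.length < r := by
      rw [hp, SimpleGraph.dist_comm]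
      exact hu
    exact (ψ.dist_vertexMap_le hψ p hp'.le).trans_lt hp'
  { toFun := fun e => ⟨ψ.onE ⟨e, N.mem_ballEdges hu e.2⟩, (ψ.mem_ends_onE hu.le _).2 e.2⟩
    invFun := fun e => ⟨ψ.onE.symm ⟨e, N'.mem_ballEdges hu' e.2⟩, by
      rw [← ψ.mem_ends_onE hu.le, Equiv.apply_symm_apply]
      exact e.2⟩
    left_inv := fun e => by simp
    right_inv := fun e => by simp }

theorem ofReal_cond_le (e : N.ballEdges x r) : ENNReal.ofReal (N.cond e) ≤
    ENNReal.ofReal (N'.cond (ψ.onE e)) + ENNReal.ofReal ε := by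
  refine le_trans (ENNReal.ofReal_le_ofReal ?_) ENNReal.ofReal_add_le
  linarith [(abs_lt.1 (ψ.cond_lt e)).1]

theorem ofReal_cond_ge (e : N.ballEdges x r) : ENNReal.ofReal (N'.cond (ψ.onE e)) ≤
    ENNReal.ofReal (N.cond e) + ENNReal.ofReal ε := by
  refine le_trans (ENNReal.ofReal_le_ofReal ?_) ENNReal.ofReal_add_le
  linarith [(abs_lt.1 (ψ.cond_lt e)).2]

theorem totalRate_le (hψ : ψ.Sends x x') {u : N.V} (hu : N.simpleGraph.dist x u < r) :
    N.totalRate u ≤ N'.totalRate (ψ.vertexMap u) +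
      ∑' _ : {e : N.E // u ∈ N.ends e}, ENNReal.ofReal ε := by
  rw [totalRate, totalRate, ← (ψ.edgesAtEquiv hψ hu).tsum_eq, ← ENNReal.tsum_add]
  exact ENNReal.tsum_le_tsum fun e => ψ.ofReal_cond_le _

theorem totalRate_ge (hψ : ψ.Sends x x') {u : N.V} (hu : N.simpleGraph.dist x u < r) :
    N'.totalRate (ψ.vertexMap u) ≤ N.totalRate u +
      ∑' _ : {e : N.E // u ∈ N.ends e}, ENNReal.ofReal ε := by
  rw [totalRate, totalRate, ← (ψ.edgesAtEquiv hψ hu).tsum_eq, ← ENNReal.tsum_add]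
  exact ENNReal.tsum_le_tsum fun e => ψ.ofReal_cond_ge _

theorem rate_le {u v : N.V} (hu : u ∈ N.ball x r) (hv : v ∈ N.ball x r) :
    N.rate u v ≤ N'.rate (ψ.vertexMap u) (ψ.vertexMap v) +
      ∑' _ : {e : N.E // u ∈ N.ends e}, ENNReal.ofReal ε := by
  have hmem : ∀ e : {e : N.E // N.ends e = s(u, v)}, e.1 ∈ N.ballEdges x r := by
    rintro ⟨e, he⟩ z hz
    rw [he, Sym2.mem_iff] at hz
    rcases hz with rfl | rfl
    · exact hu
    · exact hv
  calc N.rate u v ≤ ∑' e : {e : N.E // N.ends e = s(u, v)},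
        (ENNReal.ofReal (N'.cond (ψ.onE ⟨e, hmem e⟩)) + ENNReal.ofReal ε) :=
        ENNReal.tsum_le_tsum fun e => ψ.ofReal_cond_le ⟨e, hmem e⟩
    _ ≤ _ := by
      rw [ENNReal.tsum_add]
      refine add_le_add ?_ ?_
      · refine ENNReal.tsum_comp_le_tsum_of_injective
          (f := fun e : {e : N.E // N.ends e = s(u, v)} =>
            (⟨ψ.onE ⟨e, hmem e⟩, ψ.ends_onE hu hv _ e.2⟩ :
              {e : N'.E // N'.ends e = s(ψ.vertexMap u, ψ.vertexMap v)})) ?_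
          (fun e => ENNReal.ofReal (N'.cond e))
        intro e e' h
        have h1 := ψ.onE.injective (Subtype.ext (Subtype.mk.inj h))
        exact Subtype.ext (Subtype.mk.inj h1)
      · refine ENNReal.tsum_comp_le_tsum_of_injective
          (f := fun e : {e : N.E // N.ends e = s(u, v)} =>
            (⟨e, by rw [e.2]; exact Sym2.mem_mk_left _ _⟩ : {e : N.E // u ∈ N.ends e})) ?_
          (fun _ => ENNReal.ofReal ε)
        intro e e' h
        exact Subtype.ext (Subtype.mk.inj h)

end BallIso

theorem tendsto_tsum_edges (N : Network) (u : N.V) {ε : ℕ → ℝ} (hε : Tendsto ε atTop (𝓝 0)) :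
    Tendsto (fun k => ∑' _ : {e : N.E // u ∈ N.ends e}, ENNReal.ofReal (ε k)) atTop (𝓝 0) := by
  have : Finite {e : N.E // u ∈ N.ends e} := N.locallyFinite u
  simp_rw [ENNReal.tsum_const]
  have h := ENNReal.Tendsto.const_mul (a := (ENat.card {e : N.E // u ∈ N.ends e} : ℝ≥0∞))
    (ENNReal.tendsto_ofReal hε) (Or.inr (by simpa using this))
  simpa only [ENNReal.ofReal_zero, mul_zero] using h

theorem isLocalLimit_of_ballIso {N : Network} {x : N.V} {M : ℕ → Network} {y : ∀ k, (M k).V}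
    {r : ℕ → ℕ} {ε : ℕ → ℝ} (hr : Tendsto r atTop atTop) (hε : Tendsto ε atTop (𝓝 0))
    (ψ : ∀ k, BallIso N x (M k) (y k) (r k) (ε k)) (hψ : ∀ k, (ψ k).Sends x (y k)) :
    IsLocalLimit N M fun k => (ψ k).vertexMap := by
  have hball : ∀ u, ∀ᶠ k in atTop, N.simpleGraph.dist x u < r k := fun u =>
    hr.eventually_gt_atTop _
  refine ⟨fun u v huv => ?_, fun u v => ?_, fun u => ?_⟩
  · filter_upwards [hball u, hball v] with k hu hv
    exact (ψ k).vertexMap_injOn.ne hu.le hv.le huv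
  · have h1 : Tendsto (fun k => N.rate u v - ∑' _ : {e : N.E // u ∈ N.ends e}, ENNReal.ofReal (ε k))
        atTop (𝓝 (N.rate u v - 0)) :=
      ENNReal.Tendsto.sub tendsto_const_nhds (N.tendsto_tsum_edges u hε) (Or.inr (by simp))
    rw [tsub_zero] at h1
    rw [← h1.liminf_eq]
    refine liminf_le_liminf ?_
    filter_upwards [hball u, hball v] with k hu hv
    exact tsub_le_iff_right.2 ((ψ k).rate_le hu.le hv.le)
  · have h1 : Tendsto (fun k => N.totalRate u -
        ∑' _ : {e : N.E // u ∈ N.ends e}, ENNReal.ofReal (ε k)) atTop (𝓝 (N.totalRate u - 0)) :=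
      ENNReal.Tendsto.sub tendsto_const_nhds (N.tendsto_tsum_edges u hε) (Or.inr (by simp))
    have h2 : Tendsto (fun k => N.totalRate u +
        ∑' _ : {e : N.E // u ∈ N.ends e}, ENNReal.ofReal (ε k)) atTop (𝓝 (N.totalRate u + 0)) :=
      tendsto_const_nhds.add (N.tendsto_tsum_edges u hε)
    rw [tsub_zero] at h1
    rw [add_zero] at h2
    refine tendsto_of_tendsto_of_tendsto_of_le_of_le' h1 h2 ?_ ?_
    · filter_upwards [hball u] with k hu
      exact tsub_le_iff_right.2 ((ψ k).totalRate_le (hψ k) hu)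
    · filter_upwards [hball u] with k hu
      exact (ψ k).totalRate_ge (hψ k) hu

def BallIso.refl (N : Network) (x : N.V) (r : ℕ) {ε : ℝ} (hε : 0 < ε) : BallIso N x N x r ε where
  onV := Equiv.refl _
  onE := Equiv.refl _
  cond_lt e := by simpa using hε
  mem_ends e v := Iff.rfl

/-- A function of networks with one root which is lower semicontinuous under local limits. -/
def IsLowerSemicontinuous₁ (F : ∀ N : Network, N.V → ℝ≥0∞) : Prop :=
  ∀ (N : Network) (M : ℕ → Network) (φ : ∀ k, N.V → (M k).V), IsLocalLimit N M φ →
    ∀ u, F N u ≤ liminf (fun k => F (M k) (φ k u)) atTop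

/-- A function of networks with two roots which is lower semicontinuous under local limits. -/
def IsLowerSemicontinuous₂ (F : ∀ N : Network, N.V → N.V → ℝ≥0∞) : Prop :=
  ∀ (N : Network) (M : ℕ → Network) (φ : ∀ k, N.V → (M k).V), IsLocalLimit N M φ →
    ∀ u v, F N u v ≤ liminf (fun k => F (M k) (φ k u) (φ k v)) atTop

/-- An isomorphism exhibits each network as the local limit of the constant sequence at the other,
which gives both inequalities. -/
theorem IsLowerSemicontinuous₁.iso_eq {F : ∀ N : Network, N.V → ℝ≥0∞}
    (hF : IsLowerSemicontinuous₁ F) {N N' : Network} (φ : Iso N N') (u : N.V) :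
    F N' (φ.onV u) = F N u := by
  refine le_antisymm ?_ ?_
  · simpa [Iso.symm] using hF _ _ _ φ.symm.isLocalLimit (φ.onV u)
  · simpa using hF _ _ _ φ.isLocalLimit u

theorem IsLowerSemicontinuous₂.iso_eq {F : ∀ N : Network, N.V → N.V → ℝ≥0∞}
    (hF : IsLowerSemicontinuous₂ F) {N N' : Network} (φ : Iso N N') (u v : N.V) :
    F N' (φ.onV u) (φ.onV v) = F N u v := by
  refine le_antisymm ?_ ?_
  · simpa [Iso.symm] using hF _ _ _ φ.symm.isLocalLimit (φ.onV u) (φ.onV v)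
  · simpa using hF _ _ _ φ.isLocalLimit u v

end Network

/-! ### From semicontinuity to Borel measurability -/

instance RootedNetworkSpace.borelSpace : BorelSpace RootedNetworkSpace := ⟨rfl⟩

instance DoublyRootedNetworkSpace.borelSpace : BorelSpace DoublyRootedNetworkSpace := ⟨rfl⟩

/-- Sequential criterion for a superlevel set to contain some `U k`: otherwise a bad point chosen in
each `U k` gives a sequence with `liminf` at most `a`. -/
theorem exists_lt_forall_of_liminf {α : Type*} {F : α → ℝ≥0∞} {a : ℝ≥0∞} {U : ℕ → Set α}
    (h : ∀ x : ℕ → α, (∀ k, x k ∈ U k) → a < liminf (fun k => F (x k)) atTop) :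
    ∃ k, ∀ x ∈ U k, a < F x := by
  by_contra! hcon
  choose x hxU hx using hcon
  refine (h x hxU).not_ge (liminf_le_of_le (by isBoundedDefault) fun b hb => ?_)
  obtain ⟨k, hk⟩ := hb.exists
  exact hk.trans (hx k)

namespace Network

/-- The function on the space of rooted networks defined by a function of rooted networks. -/
noncomputable def IsLowerSemicontinuous₁.lift {F : ∀ N : Network, N.V → ℝ≥0∞}
    (hF : IsLowerSemicontinuous₁ F) : RootedNetworkSpace → ℝ≥0∞ :=
  Quotient.lift (fun N : RootedNetwork => F N.toNetwork N.root) (by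
    rintro N N' ⟨φ, h⟩
    rw [← h]
    exact (hF.iso_eq φ _).symm)

/-- The function on the space of doubly rooted networks defined by a function of doubly rooted
networks. -/
noncomputable def IsLowerSemicontinuous₂.lift {F : ∀ N : Network, N.V → N.V → ℝ≥0∞}
    (hF : IsLowerSemicontinuous₂ F) : DoublyRootedNetworkSpace → ℝ≥0∞ :=
  Quotient.lift (fun N : DoublyRootedNetwork => F N.toNetwork N.root₁ N.root₂) (by
    rintro N N' ⟨φ, h₁, h₂⟩
    rw [← h₁, ← h₂]
    exact (hF.iso_eq φ _ _).symm)

theorem IsLowerSemicontinuous₁.measurable_lift {F : ∀ N : Network, N.V → ℝ≥0∞}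
    (hF : IsLowerSemicontinuous₁ F) : Measurable hF.lift := by
  refine measurable_of_Ioi fun a => IsOpen.measurableSet (isOpen_iff_forall_mem_open.2 fun g hg => ?_)
  induction g using Quotient.inductionOn with | _ N
  obtain ⟨k, hk⟩ := exists_lt_forall_of_liminf (F := hF.lift) (a := a)
    (U := fun k : ℕ => N.nbhd k (1 / ((k : ℝ) + 1))) (by
      intro g hgk
      choose M hM ψ hψ using hgk
      have h1 := hF _ _ _ (isLocalLimit_of_ballIso tendsto_id
        tendsto_one_div_add_atTop_nhds_zero_nat ψ hψ) N.root
      refine lt_of_lt_of_le hg (h1.trans_eq ?_)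
      congr 1
      ext k
      rw [← hM k, (hψ k).vertexMap_eq]
      rfl)
  exact ⟨_, hk, TopologicalSpace.isOpen_generateFrom_of_mem ⟨N, k, _, by positivity, rfl⟩,
    N, rfl, BallIso.refl _ _ _ (by positivity),
    ⟨N.root, by simp [ball]⟩, rfl, rfl⟩

theorem IsLowerSemicontinuous₂.measurable_lift {F : ∀ N : Network, N.V → N.V → ℝ≥0∞}
    (hF : IsLowerSemicontinuous₂ F) : Measurable hF.lift := by
  refine measurable_of_Ioi fun a => IsOpen.measurableSet (isOpen_iff_forall_mem_open.2 fun g hg => ?_)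
  induction g using Quotient.inductionOn with | _ N
  -- Adding the distance of the roots to the radius keeps `root₂` in the ball for every `k`.
  obtain ⟨k, hk⟩ := exists_lt_forall_of_liminf (F := hF.lift) (a := a)
    (U := fun k : ℕ => N.nbhd (k + N.simpleGraph.dist N.root₁ N.root₂) (1 / ((k : ℝ) + 1))) (by
      intro g hgk
      choose M hM ψ hψ₁ hψ₂ using hgk
      have h1 := hF _ _ _ (isLocalLimit_of_ballIso (tendsto_add_atTop_nat _)
        tendsto_one_div_add_atTop_nhds_zero_nat ψ hψ₁) N.root₁ N.root₂
      refine lt_of_lt_of_le hg (h1.trans_eq ?_)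
      congr 1
      ext k
      rw [← hM k, (hψ₁ k).vertexMap_eq, (hψ₂ k).vertexMap_eq]
      rfl)
  exact ⟨_, hk, TopologicalSpace.isOpen_generateFrom_of_mem ⟨N, _, _, by positivity, rfl⟩,
    N, rfl, BallIso.refl _ _ _ (by positivity),
    ⟨⟨N.root₁, by simp [ball]⟩, rfl, rfl⟩, ⟨⟨N.root₂, by simp [ball]⟩, rfl, rfl⟩⟩

end Network

/-! ### Mass transport along collisions -/

namespace Network

theorem isLowerSemicontinuous_heatKernel (n : ℕ) :
    IsLowerSemicontinuous₂ fun N u v => N.heatKernel n u v :=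
  fun _ _ _ h u v => h.heatKernel_le n.cast_nonneg u v

theorem isLowerSemicontinuous_noCollision (k : ℕ) :
    IsLowerSemicontinuous₁ fun N u => noCollision (N.heatKernel 1) k u u :=
  fun _ _ _ h u => h.noCollision_le k u u

theorem isLowerSemicontinuous_noCollision_fst (k : ℕ) :
    IsLowerSemicontinuous₂ fun N u _ => noCollision (N.heatKernel 1) k u u :=
  fun _ _ _ h u _ => h.noCollision_le k u u

theorem tsum_heatKernel_sq (N : Network) (n : ℕ) (u : N.V) :
    ∑' v, N.heatKernel n u v * N.heatKernel n u v = N.heatKernel (n + n) u u := by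
  rw [N.heatKernel_add n.cast_nonneg n.cast_nonneg]
  exact tsum_congr fun v => by rw [N.heatKernel_comm n.cast_nonneg v u]

/-- Symmetry of the kernel turns walks from all `u` to `ρ` into walks from `ρ`, to which the
last-collision decomposition applies. -/
theorem tsum_collision_le_one (N : Network) (ρ : N.V) :
    ∑' u, (∑' n : ℕ, N.heatKernel n u ρ * N.heatKernel n u ρ) *
      ⨅ k, noCollision (N.heatKernel 1) k u u ≤ 1 := by
  simp_rw [← ENNReal.tsum_mul_right, N.heatKernel_comm (Nat.cast_nonneg _) _ ρ]
  rw [ENNReal.tsum_comm]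
  refine tsum_lastCollision_le_one (q := fun n : ℕ => N.heatKernel n)
    (N.tsum_heatKernel_le zero_le_one) (fun x y => ?_) (fun n x y => ?_) ρ
  · simpa using N.heatKernel_zero x y
  · rw [← N.heatKernel_add zero_le_one n.cast_nonneg]
    push_cast
    rw [add_comm]

end Network

/-- The expected number of collisions at `root₂` at integer times of two independent walks from
`root₁`, times the probability that two independent walks from `root₁` do not collide at positive
integer times. -/
noncomputable def collisionMass (g : DoublyRootedNetworkSpace) : ℝ≥0∞ :=
  (∑' n, (Network.isLowerSemicontinuous_heatKernel n).lift g *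
    (Network.isLowerSemicontinuous_heatKernel n).lift g) *
    ⨅ k, (Network.isLowerSemicontinuous_noCollision_fst k).lift g

theorem measurable_collisionMass : Measurable collisionMass :=
  (Measurable.tsum fun n =>
    (Network.isLowerSemicontinuous_heatKernel n).measurable_lift.mul
      (Network.isLowerSemicontinuous_heatKernel n).measurable_lift).mul
    (Measurable.iInf fun k => (Network.isLowerSemicontinuous_noCollision_fst k).measurable_lift)

theorem massIn_collisionMass_le (g : RootedNetworkSpace) : massIn collisionMass g ≤ 1 := by
  induction g using Quotient.inductionOn with | _ N
  exact N.tsum_collision_le_one N.root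

/-- By Chapman–Kolmogorov and symmetry the squares sum to return probabilities at even times, whose
sum is infinite by recurrence. -/
theorem massOut_collisionMass {N : RootedNetwork} (hN : N.Recurrent) :
    massOut collisionMass N.toClass =
      ∞ * ⨅ k, (Network.isLowerSemicontinuous_noCollision k).lift N.toClass := by
  change ∑' v, (∑' n : ℕ, N.heatKernel n N.root v * N.heatKernel n N.root v) *
    (⨅ k, noCollision (N.heatKernel 1) k N.root N.root) =
    ∞ * ⨅ k, noCollision (N.heatKernel 1) k N.root N.root
  rw [ENNReal.tsum_mul_right, ENNReal.tsum_comm]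
  simp_rw [N.tsum_heatKernel_sq]
  rw [hN.tsum_heatKernel_even]

theorem ae_iInf_noCollision_eq_zero {Ω : Type*} [MeasurableSpace Ω] (P : Measure Ω)
    [IsProbabilityMeasure P] (G : Ω → RootedNetworkSpace) (hG : Measurable G)
    (hunimodular : IsUnimodular P G)
    (hrecurrent : ∀ᵐ ω ∂P, ∀ N : RootedNetwork, N.toClass = G ω → N.Recurrent) :
    ∀ᵐ ω ∂P, ∀ N : RootedNetwork, N.toClass = G ω → ∀ x y : N.V, x ≠ y →
      ⨅ k, noCollision (N.heatKernel 1) k x y = 0 := by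
  let H : RootedNetworkSpace → ℝ≥0∞ := fun g =>
    ⨅ k, (Network.isLowerSemicontinuous_noCollision k).lift g
  have hH : Measurable H :=
    Measurable.iInf fun k => (Network.isLowerSemicontinuous_noCollision k).measurable_lift
  have hint : ∫⁻ ω, ∞ * H (G ω) ∂P ≤ 1 := by
    calc ∫⁻ ω, ∞ * H (G ω) ∂P = ∫⁻ ω, massOut collisionMass (G ω) ∂P := by
          refine lintegral_congr_ae ?_
          filter_upwards [hrecurrent] with ω hω
          obtain ⟨N, hN⟩ := Quotient.exists_rep (G ω)
          rw [← show N.toClass = G ω from hN, massOut_collisionMass (hω N hN)]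
      _ = ∫⁻ ω, massIn collisionMass (G ω) ∂P := hunimodular _ measurable_collisionMass
      _ ≤ ∫⁻ _, 1 ∂P := lintegral_mono fun ω => massIn_collisionMass_le _
      _ = 1 := by simp
  -- Since `∞ * H` takes only the values `0` and `∞`, its finite integral forces `H (G ω) = 0`
  -- almost surely.
  have hae := ae_lt_top ((hH.comp hG).const_mul ∞) (hint.trans_lt ENNReal.one_lt_top).ne
  filter_upwards [hae] with ω hω N hN x y hxy
  refine iInf_noCollision_eq_zero_of_root (N.tsum_heatKernel_le zero_le_one)
    (N.heatKernel_ne_zero zero_lt_one) (ρ := N.root) ?_ hxy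
  by_contra h0
  have h1 : H (G ω) ≠ 0 := by rw [← hN]; exact h0
  exact hω.ne (ENNReal.top_mul h1)

/-! ### Collisions of the walks -/

/-- Cut `A` into its parts in `[n, n + 1)` and translate them to `[0, 1)`. If `A` had finite
measure, Borel–Cantelli would put almost every point in only finitely many of the translates. -/
theorem volume_eq_top_of_frequently_add_natCast_mem {A : Set ℝ} (hA : MeasurableSet A)
    (h : ∀ᵐ s : ℝ, 0 ≤ s → ∃ᶠ n : ℕ in atTop, s + n ∈ A) : volume A = ∞ := by
  by_contra htop
  let B : ℕ → Set ℝ := fun n => (fun s : ℝ => s + n) ⁻¹' (A ∩ Set.Ico (n : ℝ) (n + 1))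
  have hB : ∑' n, volume (B n) ≠ ∞ := by
    simp only [B, measure_preimage_add_right]
    rw [← measure_iUnion]
    · exact ne_top_of_le_ne_top htop
        (measure_mono (Set.iUnion_subset fun n => Set.inter_subset_left))
    · have hIco : Pairwise (Function.onFun Disjoint fun n : ℕ => Set.Ico (n : ℝ) (n + 1)) := by
        intro m n hmn
        rw [Function.onFun, Set.disjoint_left]
        intro x hx hx'
        refine hmn ?_
        have h1 : (m : ℝ) < n + 1 := hx.1.trans_lt hx'.2
        have h2 : (n : ℝ) < m + 1 := hx'.1.trans_lt hx.2
        norm_cast at h1 h2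
        omega
      exact hIco.mono fun m n hmn => hmn.mono Set.inter_subset_right Set.inter_subset_right
    · exact fun n => hA.inter measurableSet_Ico
  have hae := ae_eventually_notMem hB
  have h01 : volume (Set.Ico (0 : ℝ) 1) = 0 := by
    refine measure_mono_null (fun s hs => ?_) (ae_iff.1 (h.and hae))
    rintro ⟨h1, h2⟩
    obtain ⟨n, hn, hn'⟩ := ((h1 hs.1).and_eventually h2).exists
    exact hn' ⟨hn, by simpa using hs.1, by linarith [hs.2]⟩
  simp at h01

namespace Network

instance instDiscreteMeasurableSpaceV (N : Network) : DiscreteMeasurableSpace N.V :=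
  ⟨fun _ => trivial⟩

/-! ### The walks sampled at the times `s + n` -/

namespace IsContinuousTimeWalk

variable {N : Network} {Ω : Type*} [MeasurableSpace Ω] {P : Measure Ω}
  {X Y : ℝ≥0 → Ω → N.V} {u v : N.V}

theorem ae_zero_eq [IsProbabilityMeasure P] (hX : N.IsContinuousTimeWalk u P X) : ∀ᵐ ω ∂P, X 0 ω = u := by
  have h := hX.fdd 0 (fun _ => 0) (fun _ => u) monotone_const rfl rfl
  simp only [Nat.le_zero, forall_eq, Finset.range_zero, Finset.prod_empty] at h
  exact (mem_ae_iff_prob_eq_one (hX.measurable 0 (measurableSet_singleton u))).2 h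

theorem measure_path (hX : N.IsContinuousTimeWalk u P X) (hY : N.IsContinuousTimeWalk v P Y)
    (hXY : IndepFun (fun ω t => X t ω) (fun ω t => Y t ω) P) (n : ℕ) {t : ℕ → ℝ≥0}
    (ht : Monotone t) (ht0 : t 0 = 0) {x y : ℕ → N.V} (hx : x 0 = u) (hy : y 0 = v) :
    P {ω | (∀ i ≤ n, X (t i) ω = x i) ∧ ∀ i ≤ n, Y (t i) ω = y i} =
      (∏ i ∈ Finset.range n, N.heatKernel ((t (i + 1) : ℝ) - t i) (x i) (x (i + 1))) *
      ∏ i ∈ Finset.range n, N.heatKernel ((t (i + 1) : ℝ) - t i) (y i) (y (i + 1)) := by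
  have hmeas : ∀ z : ℕ → N.V, MeasurableSet {f : ℝ≥0 → N.V | ∀ i ≤ n, f (t i) = z i} := by
    intro z
    have : {f : ℝ≥0 → N.V | ∀ i ≤ n, f (t i) = z i} =
        ⋂ i, ⋂ _ : i ≤ n, (fun f : ℝ≥0 → N.V => f (t i)) ⁻¹' {z i} := by
      ext f; simp
    rw [this]
    exact MeasurableSet.iInter fun i => MeasurableSet.iInter fun _ =>
      measurable_pi_apply _ (measurableSet_singleton _)
  rw [← hX.fdd n t x ht ht0 hx, ← hY.fdd n t y ht ht0 hy]
  exact hXY.measure_inter_preimage_eq_mul _ _ (hmeas x) (hmeas y)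

/-- Induction on `k`: summing over the two positions at time `t (n + 2)` reproduces the recursion of
`noCollision`. The first increment of `t` is arbitrary, so sampling may start at any time; the later
increments are one. -/
theorem measure_path_noCollision_le (hX : N.IsContinuousTimeWalk u P X)
    (hY : N.IsContinuousTimeWalk v P Y)
    (hXY : IndepFun (fun ω t => X t ω) (fun ω t => Y t ω) P) {t : ℕ → ℝ≥0}
    (ht : Monotone t) (ht0 : t 0 = 0) (ht1 : ∀ i, t (i + 2) = t (i + 1) + 1) (k n : ℕ)
    {x y : ℕ → N.V} (hx : x 0 = u) (hy : y 0 = v) :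
    P {ω | ((∀ i ≤ n + 1, X (t i) ω = x i) ∧ ∀ i ≤ n + 1, Y (t i) ω = y i) ∧
        ∀ j < k, X (t (n + 2 + j)) ω ≠ Y (t (n + 2 + j)) ω} ≤
      P {ω | (∀ i ≤ n + 1, X (t i) ω = x i) ∧ ∀ i ≤ n + 1, Y (t i) ω = y i} *
        noCollision (N.heatKernel 1) k (x (n + 1)) (y (n + 1)) := by
  classical
  induction k generalizing n x y with
  | zero => simp [noCollision]
  | succ k ih =>
    let x' : N.V → ℕ → N.V := fun a => Function.update x (n + 2) a
    let y' : N.V → ℕ → N.V := fun a => Function.update y (n + 2) a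
    let S : N.V → N.V → Set Ω := fun a b =>
      {ω | ((∀ i ≤ n + 2, X (t i) ω = x' a i) ∧ ∀ i ≤ n + 2, Y (t i) ω = y' b i) ∧
        ∀ j < k, X (t (n + 3 + j)) ω ≠ Y (t (n + 3 + j)) ω}
    have hupd : ∀ (z : ℕ → N.V) (a : N.V) (i : ℕ), i ≤ n + 1 →
        Function.update z (n + 2) a i = z i := fun z a i hi =>
      Function.update_of_ne (by omega) _ _
    have hsub : {ω | ((∀ i ≤ n + 1, X (t i) ω = x i) ∧ ∀ i ≤ n + 1, Y (t i) ω = y i) ∧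
        ∀ j < k + 1, X (t (n + 2 + j)) ω ≠ Y (t (n + 2 + j)) ω} ⊆
        ⋃ a, ⋃ b, if a = b then ∅ else S a b := by
      rintro ω ⟨⟨h1, h2⟩, h3⟩
      rw [Set.mem_iUnion]
      refine ⟨X (t (n + 2)) ω, ?_⟩
      rw [Set.mem_iUnion]
      refine ⟨Y (t (n + 2)) ω, ?_⟩
      rw [if_neg (h3 0 k.succ_pos)]
      refine ⟨⟨fun i hi => ?_, fun i hi => ?_⟩, fun j hj => ?_⟩
      · rcases Nat.le_succ_iff.1 hi with hi | rfl
        · simp only [x', hupd x _ i hi, h1 i hi]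
        · simp [x']
      · rcases Nat.le_succ_iff.1 hi with hi | rfl
        · simp only [y', hupd y _ i hi, h2 i hi]
        · simp [y']
      · have := h3 (j + 1) (by omega)
        rwa [show n + 2 + (j + 1) = n + 3 + j by ring] at this
    have hstep : ∀ a b, P (S a b) ≤
        P {ω | (∀ i ≤ n + 1, X (t i) ω = x i) ∧ ∀ i ≤ n + 1, Y (t i) ω = y i} *
          (N.heatKernel 1 (x (n + 1)) a * N.heatKernel 1 (y (n + 1)) b *
            noCollision (N.heatKernel 1) k a b) := by
      intro a b
      have hprod : ∀ (z : ℕ → N.V) (c : N.V), ∏ i ∈ Finset.range (n + 2),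
          N.heatKernel ((t (i + 1) : ℝ) - t i) (Function.update z (n + 2) c i)
            (Function.update z (n + 2) c (i + 1)) =
          (∏ i ∈ Finset.range (n + 1),
            N.heatKernel ((t (i + 1) : ℝ) - t i) (z i) (z (i + 1))) *
            N.heatKernel 1 (z (n + 1)) c := by
        intro z c
        rw [Finset.prod_range_succ]
        congr 1
        · refine Finset.prod_congr rfl fun i hi => ?_
          rw [Finset.mem_range] at hi
          rw [hupd z c i (by omega), hupd z c (i + 1) (by omega)]
        · rw [hupd z c (n + 1) le_rfl, Function.update_self, ht1 n]
          push_cast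
          rw [add_sub_cancel_left]
      have h0 : ∀ (z : ℕ → N.V) (c : N.V), Function.update z (n + 2) c 0 = z 0 := fun z c =>
        hupd z c 0 (Nat.zero_le _)
      have h1 := ih (n + 1) (x := x' a) (y := y' b) ((h0 x a).trans hx) ((h0 y b).trans hy)
      refine h1.trans_eq ?_
      rw [hX.measure_path hY hXY (n + 1 + 1) ht ht0 ((h0 x a).trans hx) ((h0 y b).trans hy),
        hX.measure_path hY hXY (n + 1) ht ht0 hx hy, hprod, hprod]
      simp only [x', y', Function.update_self]
      ring
    refine (measure_mono hsub).trans ((measure_iUnion_le _).trans ?_)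
    rw [noCollision, ← ENNReal.tsum_mul_left]
    refine ENNReal.tsum_le_tsum fun a => (measure_iUnion_le _).trans ?_
    rw [← ENNReal.tsum_mul_left]
    refine ENNReal.tsum_le_tsum fun b => ?_
    split_ifs
    · simp
    · exact hstep a b

/-- If collisions stopped, then for some `m` the walks would sit at distinct vertices `x`, `y` at
time `s + m` and never collide at the later sampled times. These are countably many null events. -/
theorem ae_frequently_eq [IsProbabilityMeasure P]
    (hX : N.IsContinuousTimeWalk u P X) (hY : N.IsContinuousTimeWalk v P Y)
    (hXY : IndepFun (fun ω t => X t ω) (fun ω t => Y t ω) P)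
    (hN : ∀ x y : N.V, x ≠ y → ⨅ k, noCollision (N.heatKernel 1) k x y = 0) (s : ℝ≥0) :
    ∀ᵐ ω ∂P, ∃ᶠ n : ℕ in atTop, X (s + n) ω = Y (s + n) ω := by
  have hnull : ∀ (m : ℕ) (x y : N.V), x ≠ y → ∀ᵐ ω ∂P,
      ¬ ((X 0 ω = u ∧ Y 0 ω = v) ∧ (X (s + m) ω = x ∧ Y (s + m) ω = y) ∧
        ∀ j : ℕ, X (s + m + 1 + j) ω ≠ Y (s + m + 1 + j) ω) := by
    intro m x y hxy
    -- The finite-dimensional distributions require the initial time `0`; the sampled times `s + m,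
    -- s + m + 1, …` start at index `1`.
    let t : ℕ → ℝ≥0 := fun i => match i with
      | 0 => 0
      | i + 1 => s + m + i
    let z : N.V → N.V → ℕ → N.V := fun a b i => match i with
      | 0 => a
      | _ + 1 => b
    have ht : Monotone t := by
      refine monotone_nat_of_le_succ fun i => ?_
      cases i with
      | zero => exact zero_le
      | succ i => simp only [t]; gcongr; exact i.le_succ
    have ht1 : ∀ i, t (i + 2) = t (i + 1) + 1 := by
      intro i
      simp only [t]
      push_cast
      ring
    rw [ae_iff]
    refine le_antisymm ?_ zero_le
    rw [← hN x y hxy]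
    refine le_iInf fun k => ?_
    refine (measure_mono fun ω hω => ?_).trans ((hX.measure_path_noCollision_le hY hXY ht rfl ht1
      k 0 (x := z u x) (y := z v y) rfl rfl).trans (mul_le_of_le_one_left zero_le prob_le_one))
    obtain ⟨⟨h1, h2⟩, ⟨h3, h4⟩, h5⟩ := not_not.1 hω
    refine ⟨⟨fun i hi => ?_, fun i hi => ?_⟩, fun j _ => ?_⟩
    · interval_cases i
      · exact h1
      · simpa [t, z] using h3
    · interval_cases i
      · exact h2
      · simpa [t, z] using h4
    · have : t (0 + 2 + j) = s + m + 1 + j := by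
        rw [show 0 + 2 + j = (j + 1) + 1 by ring]
        simp only [t]
        push_cast
        ring
      rw [this]
      exact h5 j
  have hnull' : ∀ᵐ ω ∂P, ∀ (m : ℕ) (x y : N.V), x ≠ y →
      ¬ ((X 0 ω = u ∧ Y 0 ω = v) ∧ (X (s + m) ω = x ∧ Y (s + m) ω = y) ∧
        ∀ j : ℕ, X (s + m + 1 + j) ω ≠ Y (s + m + 1 + j) ω) := by
    rw [ae_all_iff]
    refine fun m => ae_all_iff.2 fun x => ae_all_iff.2 fun y => ?_
    by_cases hxy : x = y
    · simp [hxy]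
    · filter_upwards [hnull m x y hxy] with ω hω _ using hω
  filter_upwards [hX.ae_zero_eq, hY.ae_zero_eq, hnull'] with ω h1 h2 h3
  rw [frequently_atTop]
  intro m
  by_contra! hcon
  refine h3 m _ _ (hcon m le_rfl) ⟨⟨h1, h2⟩, ⟨rfl, rfl⟩, fun j => ?_⟩
  have := hcon (m + 1 + j) (by omega)
  push_cast at this
  rwa [show s + (m + 1 + j : ℝ≥0) = s + m + 1 + j by ring] at this

end IsContinuousTimeWalk

/-! ### From sampled times to Lebesgue measure -/

/-- Approximations of `t` from the right by multiples of `1 / (k + 1)`. -/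
noncomputable def rightApprox (k : ℕ) (t : ℝ≥0) : ℝ≥0 :=
  (⌊t * (k + 1)⌋₊ + 1) / (k + 1)

theorem tendsto_rightApprox (t : ℝ≥0) :
    Tendsto (fun k => rightApprox k t) atTop (𝓝[≥] t) := by
  have hle : ∀ k, t ≤ rightApprox k t := fun k => by
    rw [rightApprox, le_div_iff₀ (by positivity)]
    exact (Nat.lt_floor_add_one _).le
  refine tendsto_nhdsWithin_iff.2 ⟨?_, Eventually.of_forall hle⟩
  have hlim : Tendsto (fun k : ℕ => t + 1 / ((k : ℝ≥0) + 1)) atTop (𝓝 (t + 0)) :=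
    tendsto_const_nhds.add tendsto_one_div_add_atTop_nhds_zero_nat
  rw [add_zero] at hlim
  refine tendsto_of_tendsto_of_tendsto_of_le_of_le tendsto_const_nhds hlim hle fun k => ?_
  rw [rightApprox, div_le_iff₀ (by positivity), add_mul, div_mul_cancel₀ _ (by positivity)]
  gcongr
  exact Nat.floor_le zero_le

/-- For fixed `k` the approximation takes countably many values, so joint measurability needs only
that of each `X t`. -/
theorem measurable_rightApprox_comp {N : Network} {Ω : Type*} [MeasurableSpace Ω]
    {X : ℝ≥0 → Ω → N.V} (hX : ∀ t, Measurable (X t)) (k : ℕ) :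
    Measurable fun p : ℝ≥0 × Ω => X (rightApprox k p.1) p.2 := by
  have h1 : Measurable fun p : ℕ × Ω => X (((p.1 : ℝ≥0) + 1) / (k + 1)) p.2 :=
    measurable_from_prod_countable_right fun n => hX ((n + 1) / (k + 1))
  have h2 : Measurable fun t : ℝ≥0 => ⌊t * (k + 1)⌋₊ :=
    Nat.measurable_floor.comp (measurable_id.mul_const _)
  have h3 := h1.comp ((h2.comp measurable_fst).prodMk measurable_snd)
  simpa only [Function.comp_def, rightApprox] using h3

theorem ae_volume_collisions_eq_top {N : Network}
    (hN : ∀ x y : N.V, x ≠ y → ⨅ k, noCollision (N.heatKernel 1) k x y = 0)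
    {Ω : Type*} [MeasurableSpace Ω] {P : Measure Ω} [IsProbabilityMeasure P]
    {X Y : ℝ≥0 → Ω → N.V} {u v : N.V} (hX : N.IsContinuousTimeWalk u P X)
    (hY : N.IsContinuousTimeWalk v P Y)
    (hXY : IndepFun (fun ω t => X t ω) (fun ω t => Y t ω) P) :
    ∀ᵐ ω ∂P, volume ((fun t : ℝ≥0 => (t : ℝ)) '' {t | X t ω = Y t ω}) = ∞ := by
  -- A jointly measurable substitute for the collision set, needed for Fubini; by right-continuity
  -- it agrees with the collision set along almost every path.
  let D : Set (ℝ≥0 × Ω) :=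
    {p | ∀ᶠ k in atTop, X (rightApprox k p.1) p.2 = Y (rightApprox k p.1) p.2}
  have hD : MeasurableSet D := by
    have : D = liminf (fun k => {p | X (rightApprox k p.1) p.2 = Y (rightApprox k p.1) p.2})
        atTop := by
      ext p
      simp [D, mem_liminf_iff_eventually_mem]
    rw [this]
    refine MeasurableSet.measurableSet_liminf fun k => ?_
    exact ((measurable_rightApprox_comp hX.measurable k).prodMk
      (measurable_rightApprox_comp hY.measurable k)) (MeasurableSet.of_discrete (s := {q | q.1 = q.2}))
  have hgood : ∀ᵐ ω ∂P, ∀ t, (t, ω) ∈ D ↔ X t ω = Y t ω := by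
    filter_upwards [hX.rightContinuous, hY.rightContinuous] with ω h1 h2 t
    have h : ∀ᶠ k in atTop, X (rightApprox k t) ω = X t ω ∧ Y (rightApprox k t) ω = Y t ω :=
      (tendsto_rightApprox t).eventually ((h1 t).and (h2 t))
    constructor
    · intro hD
      obtain ⟨k, hk, hk1, hk2⟩ := (hD.and h).exists
      rw [← hk1, ← hk2]
      exact hk
    · intro heq
      filter_upwards [h] with k hk
      rw [hk.1, hk.2, heq]
  -- Fubini exchanges "for every `s`, almost surely" for "almost surely, for almost every `s`".
  have hfreq : ∀ᵐ ω ∂P, ∀ᵐ s : ℝ, ∃ᶠ n : ℕ in atTop, (s.toNNReal + n, ω) ∈ D := by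
    rw [← Measure.ae_ae_comm (p := fun (s : ℝ) ω => ∃ᶠ n : ℕ in atTop, (s.toNNReal + n, ω) ∈ D)]
    · refine Eventually.of_forall fun s => ?_
      filter_upwards [hgood, hX.ae_frequently_eq hY hXY hN s.toNNReal] with ω h1 h2
      simpa only [h1] using h2
    · have : {p : ℝ × Ω | ∃ᶠ n : ℕ in atTop, (p.1.toNNReal + n, p.2) ∈ D} =
          limsup (fun n : ℕ => {p | (p.1.toNNReal + (n : ℝ≥0), p.2) ∈ D}) atTop := by
        ext p
        simp [mem_limsup_iff_frequently_mem]
      rw [this]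
      refine MeasurableSet.measurableSet_limsup fun n => ?_
      have : Measurable fun p : ℝ × Ω => (p.1.toNNReal + (n : ℝ≥0), p.2) := by fun_prop
      exact this hD
  filter_upwards [hgood, hfreq] with ω h1 h2
  have hA : (fun t : ℝ≥0 => (t : ℝ)) '' {t | X t ω = Y t ω} =
      Set.Ici 0 ∩ (fun s : ℝ => (s.toNNReal, ω)) ⁻¹' D := by
    ext s
    constructor
    · rintro ⟨t, ht, rfl⟩
      exact ⟨t.2, by simpa [h1] using ht⟩
    · rintro ⟨hs, hsD⟩
      exact ⟨s.toNNReal, (h1 _).1 hsD, Real.coe_toNNReal s hs⟩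
  rw [hA]
  refine volume_eq_top_of_frequently_add_natCast_mem (measurableSet_Ici.inter
    (Measurable.prodMk (by fun_prop) measurable_const hD)) ?_
  filter_upwards [h2] with s hs hs0
  refine hs.mono fun n hn => ⟨add_nonneg hs0 n.cast_nonneg, ?_⟩
  rw [Set.mem_preimage, Real.toNNReal_add hs0 n.cast_nonneg, Real.toNNReal_natCast]
  exact hn

end Network

theorem theorem3p2 {Ω : Type*} [MeasurableSpace Ω] (P : Measure Ω) [IsProbabilityMeasure P]
    (G : Ω → RootedNetworkSpace) (hG : Measurable G) (hunimodular : IsUnimodular P G)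
    (hrecurrent : ∀ᵐ ω ∂P, ∀ N : RootedNetwork, N.toClass = G ω → N.Recurrent) :
    ∀ᵐ ω ∂P, ∀ N : RootedNetwork, N.toClass = G ω → ∀ u v : N.V,
      ∀ (Ω' : Type*) [MeasurableSpace Ω'] (P' : Measure Ω') [IsProbabilityMeasure P']
        (X Y : ℝ≥0 → Ω' → N.V),
        N.IsContinuousTimeWalk u P' X → N.IsContinuousTimeWalk v P' Y →
        IndepFun (fun ω' t => X t ω') (fun ω' t => Y t ω') P' →
        ∀ᵐ ω' ∂P', volume ((fun t : ℝ≥0 => (t : ℝ)) '' {t | X t ω' = Y t ω'}) = ∞ := by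
  filter_upwards [ae_iInf_noCollision_eq_zero P G hG hunimodular hrecurrent]
    with ω hω N hN u v Ω' _ P' _ X Y hX hY hXY
  exact Network.ae_volume_collisions_eq_top (hω N hN) hX hY hXY
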